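/- Let $m\ge 2$ be an integer and $\beta\in\left(\frac{m-1}{m},\frac{m}{m+1}\right)$. Let $F$ be a probability distribution on $\{1,2,3,\dots\}$ that is aperiodic (the greatest common divisor of its support is $1$), whose tail satisfies $\overline F(n)=F((n,\infty))=n^{-\beta}L(n)$ for all $n\ge 1$ with a slowly varying function $L$, and for which $$\sup_{n\ge 0}\frac{n\,F(\{n\})}{\overline F(n)}<\infty .$$ Let $\boldsymbol S_i=(S_i(t):t\in\mathbb N_0)$, $i=1,\dots,m+1$, be independent renewal processes with $S_i(0)=0$ whose increments are i.i.d. with law $F$, and let $\mathsf{Range}_i=\{S_i(0),S_i(1),\dots\}$. Then $\bigcap_{i=1}^{m}\mathsf{Range}_i$ is almost surely infinite. Let $S_\ast(0)<S_\ast(1)<\cdots$ be the increasing enumeration of this set. For a finite set $A\subset\mathbb Z$ let $$\mathsf{Capacity}(A)=\sum_{a\in A}\mathbb P\big(a+S_{m+1}(t)\notin A\ \text{for all } t\ge 1\big)$$ be its capacity with respect to the walk $\boldsymbol S_{m+1}$, let $\mathsf{CR}_{0,n}=\mathsf{Capacity}\big(\{S_\ast(0),\dots,S_\ast(n-1)\}\big)$,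 the deterministic functional $\mathsf{Capacity}$ evaluated at a random set, and let $$p_{\mathsf{escape}}=\mathbb P\Big(\bigcap_{i=1}^{m+1}\mathsf{Range}_i=\{0\}\Big).$$ Then $\mathsf{CR}_{0,n}$ is integrable for every $n$ and, as $n\to\infty$, $$\frac{\mathsf{CR}_{0,n}}{n}\longrightarrow p_{\mathsf{escape}}\qquad\text{almost surely and in } L^1 .$$ -/

import Mathlib

open MeasureTheory ProbabilityTheory Filter Topology

namespace RenewalCapacity

noncomputable section

/-- A slowly varying function at infinity: measurable, eventually positive, and
`L (c x) / L x → 1` as `x → ∞` for every `c > 0`. -/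
structure SlowlyVarying (L : ℝ → ℝ) : Prop where
  measurable : Measurable L
  pos : ∀ᶠ x in atTop, 0 < L x
  ratio : ∀ c : ℝ, 0 < c → Tendsto (fun x => L (c * x) / L x) atTop (𝓝 1)

/-- The tail `n ↦ F (n, ∞)` of a distribution on `ℕ`. -/
def tail (F : Measure ℕ) (n : ℕ) : ℝ := F.real (Set.Ioi n)

/-- The conditions on the law `F` of the renewal epoch: it is carried by the positive integers, it
is aperiodic, its tail is regularly varying with index `-β`, and its point masses satisfy the
local bound `sup_n n F{n} / F(n, ∞) < ∞`. -/
structure IsEpochLaw (β : ℝ) (F : Measure ℕ) : Prop where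
  zero : F {0} = 0
  aperiodic : ∀ d : ℕ, (∀ n : ℕ, F {n} ≠ 0 → d ∣ n) → d = 1
  regularlyVarying : ∃ L : ℝ → ℝ, SlowlyVarying L ∧
    ∀ n : ℕ, 1 ≤ n → tail F n = (n : ℝ) ^ (-β) * L n
  local_bound : BddAbove (Set.range fun n : ℕ => (n : ℝ) * F.real {n} / tail F n)

/-- `S` is a renewal process started from `0` with epoch law `F`: the sequence of partial sums of
i.i.d. random variables with law `F`. -/
def IsRenewalProcess {Ω : Type*} [MeasurableSpace Ω] (F : Measure ℕ) (μ : Measure Ω)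
    (S : ℕ → Ω → ℕ) : Prop :=
  ∃ ξ : ℕ → Ω → ℕ, (∀ k, Measurable (ξ k)) ∧ (∀ k, μ.map (ξ k) = F) ∧ iIndepFun ξ μ ∧
    ∀ t ω, S t ω = ∑ k ∈ Finset.range t, ξ k ω

/-- The full range `{S 0, S 1, S 2, …}` of a process, for the outcome `ω`. -/
def rangeOf {Ω : Type*} (S : ℕ → Ω → ℕ) (ω : Ω) : Set ℕ := Set.range fun t => S t ω

/-- The common points of the ranges of a family of processes (the simultaneous renewal times). -/
def commonRange {ι Ω : Type*} (S : ι → ℕ → Ω → ℕ) (ω : Ω) : Set ℕ := ⋂ i, rangeOf (S i) ω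

/-- The simultaneous renewal process: `simultaneous S k ω` is the `k`-th point, counted from
`k = 0`, of the set of simultaneous renewal times in increasing order. -/
def simultaneous {ι Ω : Type*} (S : ι → ℕ → Ω → ℕ) (k : ℕ) (ω : Ω) : ℕ :=
  Nat.nth (fun x => x ∈ commonRange S ω) k

/-- The truncated range `{S⋆ n₁, …, S⋆ (n₂ - 1)}` of the simultaneous renewal process, as a finite
subset of `ℤ`. -/
def truncatedRange {ι Ω : Type*} (S : ι → ℕ → Ω → ℕ) (n₁ n₂ : ℕ) (ω : Ω) : Finset ℤ :=
  (Finset.Ico n₁ n₂).image fun k => (simultaneous S k ω : ℤ)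

/-- The capacity of a finite set `A ⊆ ℤ` with respect to a random walk `X` on `ℤ` started from `0`:
the sum over `a ∈ A` of the probability that the walk started from `a`, that is `a + X`, is outside
`A` at all times `t ≥ 1`. -/
def capacity {Ω : Type*} [MeasurableSpace Ω] (μ : Measure Ω) (X : ℕ → Ω → ℤ) (A : Finset ℤ) : ℝ :=
  ∑ a ∈ A, μ.real {ω | ∀ t : ℕ, 1 ≤ t → a + X t ω ∉ A}

/-- The random capacity of the truncated range of the simultaneous renewal process of the first `m`
processes, with respect to the last one. The capacity is a deterministic functional of finite sets
which is evaluated at the random set. -/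
def rangeCapacity {Ω : Type*} [MeasurableSpace Ω] (μ : Measure Ω) {m : ℕ}
    (S : Fin (m + 1) → ℕ → Ω → ℕ) (n₁ n₂ : ℕ) (ω : Ω) : ℝ :=
  capacity μ (fun t ω' => (S (Fin.last m) t ω' : ℤ))
    (truncatedRange (fun i : Fin m => S i.castSucc) n₁ n₂ ω)

/-- The probability that `0` is the only simultaneous renewal time of all the processes. -/
def escapeProb {ι Ω : Type*} [MeasurableSpace Ω] (μ : Measure Ω) (S : ι → ℕ → Ω → ℕ) : ℝ :=
  μ.real {ω | commonRange S ω = {0}}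

end

end RenewalCapacity

namespace RenewalCapacity

noncomputable section

lemma tail_nonneg (F : Measure ℕ) (n : ℕ) : 0 ≤ tail F n := measureReal_nonneg

lemma tail_antitone (F : Measure ℕ) [IsFiniteMeasure F] : Antitone (tail F) := fun _ _ h =>
  measureReal_mono (Set.Ioi_subset_Ioi h)

lemma tail_le_one (F : Measure ℕ) [IsProbabilityMeasure F] (n : ℕ) : tail F n ≤ 1 :=
  measureReal_le_one

/-- Doubling the argument of a regularly varying tail contracts it by nearly `2 ^ (-β)`. -/
lemma eventually_tail_two_mul_le {β γ : ℝ} {F : Measure ℕ} (hF : IsEpochLaw β F) (hγ : γ < β) :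
    ∃ n₀ : ℕ, ∀ n, n₀ ≤ n → tail F (2 * n) ≤ 2 ^ (-γ) * tail F n := by
  obtain ⟨L, hL, htail⟩ := hF.regularlyVarying
  have hone : (1 : ℝ) < 2 ^ (β - γ) := Real.one_lt_rpow (by norm_num) (by linarith)
  have hev := ((hL.ratio 2 (by norm_num)).eventually (gt_mem_nhds hone)).and hL.pos
  have hev' := tendsto_natCast_atTop_atTop (R := ℝ) |>.eventually hev
  obtain ⟨n₀, hn₀⟩ := eventually_atTop.1 hev'
  refine ⟨max n₀ 1, fun n hn => ?_⟩
  obtain ⟨h1, h2⟩ := hn₀ n (le_trans (le_max_left _ _) hn)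
  have hn1 : 1 ≤ n := le_trans (le_max_right _ _) hn
  have hnpos : (0 : ℝ) < n := by exact_mod_cast hn1
  rw [htail (2 * n) (by omega), htail n hn1]
  push_cast
  rw [div_lt_iff₀ h2] at h1
  rw [Real.mul_rpow (by norm_num) hnpos.le]
  have hnn : 0 < (n : ℝ) ^ (-β) := Real.rpow_pos_of_pos hnpos _
  have h2β : (0 : ℝ) < 2 ^ (-β) := Real.rpow_pos_of_pos (by norm_num) _
  have key : (2 : ℝ) ^ (-γ) = 2 ^ (-β) * 2 ^ (β - γ) := by
    rw [← Real.rpow_add (by norm_num)]; congr 1; ring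
  rw [key]
  calc (2 : ℝ) ^ (-β) * (n : ℝ) ^ (-β) * L (2 * n)
      ≤ 2 ^ (-β) * (n : ℝ) ^ (-β) * (2 ^ (β - γ) * L n) := by gcongr
    _ = _ := by ring

lemma exists_tail_le_rpow {β γ : ℝ} {F : Measure ℕ} [IsProbabilityMeasure F]
    (hF : IsEpochLaw β F) (hγ0 : 0 ≤ γ) (hγ : γ < β) :
    ∃ C : ℝ, 0 < C ∧ ∀ n : ℕ, tail F n ≤ C * ((n : ℝ) + 1) ^ (-γ) := by
  obtain ⟨n₀, hn₀⟩ := eventually_tail_two_mul_le hF hγ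
  refine ⟨(2 * n₀ + 2 : ℝ) ^ γ, by positivity, fun n => ?_⟩
  induction n using Nat.strong_induction_on with
  | _ n ih =>
    by_cases hn : n < 2 * n₀ + 1
    · refine (tail_le_one F n).trans ?_
      rw [Real.rpow_neg (by positivity), ← div_eq_mul_inv, one_le_div (by positivity)]
      refine Real.rpow_le_rpow (by positivity) ?_ hγ0
      have : (n : ℝ) < 2 * n₀ + 1 := by exact_mod_cast hn
      linarith
    · have hlt : n / 2 < n := by omega
      calc tail F n ≤ tail F (2 * (n / 2)) := tail_antitone F (by omega)
        _ ≤ 2 ^ (-γ) * tail F (n / 2) := hn₀ _ (by omega)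
        _ ≤ 2 ^ (-γ) * ((2 * n₀ + 2 : ℝ) ^ γ * (((n / 2 : ℕ) : ℝ) + 1) ^ (-γ)) := by
            gcongr; exact ih _ hlt
        _ ≤ 2 ^ (-γ) * ((2 * n₀ + 2 : ℝ) ^ γ * (((n : ℝ) + 1) / 2) ^ (-γ)) := by
            gcongr 2 ^ (-γ) * (_ * ?_)
            refine Real.rpow_le_rpow_of_nonpos (by positivity) ?_ (by linarith)
            have : (n : ℝ) + 1 ≤ 2 * ((n / 2 : ℕ) : ℝ) + 2 := by
              exact_mod_cast (by omega : n + 1 ≤ 2 * (n / 2) + 2)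
            linarith
        _ = (2 * n₀ + 2 : ℝ) ^ γ * ((n : ℝ) + 1) ^ (-γ) := by
            rw [Real.div_rpow (by positivity) (by norm_num)]
            field_simp

lemma rpow_neg_le_sub {γ : ℝ} (h0 : 0 ≤ γ) (h1 : γ < 1) (n : ℕ) :
    (1 - γ) * ((n : ℝ) + 1) ^ (-γ) ≤ ((n : ℝ) + 1) ^ (1 - γ) - (n : ℝ) ^ (1 - γ) := by
  have hpos : (0 : ℝ) < n + 1 := by positivity
  have hb := rpow_one_add_le_one_add_mul_self (s := -(1 / ((n : ℝ) + 1))) (p := 1 - γ)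
    (by rw [neg_le_neg_iff, div_le_one hpos]; linarith [(Nat.cast_nonneg n : (0 : ℝ) ≤ n)])
    (by linarith) (by linarith)
  have e1 : 1 + -(1 / ((n : ℝ) + 1)) = n / (n + 1) := by field_simp; ring
  rw [e1, Real.div_rpow (by positivity) hpos.le, div_le_iff₀ (by positivity)] at hb
  have e2 : ((n : ℝ) + 1) ^ (-γ) = (n + 1) ^ (1 - γ) / (n + 1) := by
    rw [show -γ = (1 - γ) - 1 by ring, Real.rpow_sub_one hpos.ne']
  rw [e2]
  have : (1 + (1 - γ) * -(1 / ((n : ℝ) + 1))) * (n + 1) ^ (1 - γ)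
      = (n + 1) ^ (1 - γ) - (1 - γ) * ((n + 1) ^ (1 - γ) / (n + 1)) := by ring
  linarith

lemma exists_sum_tail_le_rpow {β γ : ℝ} {F : Measure ℕ} [IsProbabilityMeasure F]
    (hF : IsEpochLaw β F) (hγ0 : 0 ≤ γ) (hγ : γ < β) (hγ1 : γ < 1) :
    ∃ C : ℝ, 0 < C ∧ ∀ N : ℕ, ∑ k ∈ Finset.range N, tail F k ≤ C * (N : ℝ) ^ (1 - γ) := by
  obtain ⟨C, hC, htail⟩ := exists_tail_le_rpow hF hγ0 hγ
  refine ⟨C / (1 - γ), by have : 0 < 1 - γ := by linarith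
                          positivity, fun N => ?_⟩
  induction N with
  | zero => simp [Real.zero_rpow (by linarith : (1 - γ) ≠ 0)]
  | succ N ih =>
    rw [Finset.sum_range_succ]
    have h1 := htail N
    have h2 := rpow_neg_le_sub hγ0 hγ1 N
    have hp : 0 < 1 - γ := by linarith
    have h3 : C * ((N : ℝ) + 1) ^ (-γ)
        ≤ C / (1 - γ) * (((N : ℝ) + 1) ^ (1 - γ) - (N : ℝ) ^ (1 - γ)) := by
      rw [div_mul_eq_mul_div, le_div_iff₀ hp]
      nlinarith
    push_cast
    linarith

lemma sum_range_convolution_le {u w : ℕ → ℝ} (hu : ∀ n, 0 ≤ u n) (hw : ∀ n, 0 ≤ w n) (N : ℕ) :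
    ∑ n ∈ Finset.range N, ∑ k ∈ Finset.range (n + 1), u k * w (n - k)
      ≤ (∑ k ∈ Finset.range N, u k) * ∑ k ∈ Finset.range N, w k := by
  calc ∑ n ∈ Finset.range N, ∑ k ∈ Finset.range (n + 1), u k * w (n - k)
      = ∑ k ∈ Finset.range N, ∑ n ∈ Finset.Ico k N, u k * w (n - k) := by
        refine Finset.sum_comm' fun x y => ?_
        simp only [Finset.mem_range, Finset.mem_Ico]; omega
    _ ≤ ∑ k ∈ Finset.range N, u k * ∑ j ∈ Finset.range N, w j := by
        refine Finset.sum_le_sum fun k _ => ?_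
        rw [← Finset.mul_sum]
        refine mul_le_mul_of_nonneg_left ?_ (hu k)
        rw [Finset.sum_Ico_eq_sum_range]
        simp only [add_tsub_cancel_left]
        exact Finset.sum_le_sum_of_subset_of_nonneg
          (Finset.range_mono (Nat.sub_le N k)) fun _ _ _ => hw _
    _ = _ := by rw [Finset.sum_mul]

lemma natCast_le_sum_mul_sum_tail {F : Measure ℕ} {u : ℕ → ℝ} (hu : ∀ n, 0 ≤ u n)
    (hrenew : ∀ n, 1 ≤ ∑ k ∈ Finset.range (n + 1), u k * tail F (n - k)) (N : ℕ) :
    (N : ℝ) ≤ (∑ k ∈ Finset.range N, u k) * ∑ k ∈ Finset.range N, tail F k := by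
  calc (N : ℝ) = ∑ n ∈ Finset.range N, (1 : ℝ) := by simp
    _ ≤ ∑ n ∈ Finset.range N, ∑ k ∈ Finset.range (n + 1), u k * tail F (n - k) :=
        Finset.sum_le_sum fun n _ => hrenew n
    _ ≤ _ := sum_range_convolution_le hu (tail_nonneg F) N

/-- The `m`-th powers of the renewal masses are not summable when `(m - 1) / m < β`. -/
lemma exists_lt_sum_pow {m : ℕ} (hm : 1 ≤ m) {β : ℝ} (hβ : ((m : ℝ) - 1) / m < β)
    {F : Measure ℕ} [IsProbabilityMeasure F] (hF : IsEpochLaw β F) {u : ℕ → ℝ}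
    (hu : ∀ n, 0 ≤ u n)
    (hrenew : ∀ n, 1 ≤ ∑ k ∈ Finset.range (n + 1), u k * tail F (n - k)) (B : ℝ) :
    ∃ N, B < ∑ n ∈ Finset.range N, u n ^ m := by
  obtain ⟨m, rfl⟩ : ∃ l, m = l + 1 := ⟨m - 1, by omega⟩
  have hmpos : (0 : ℝ) < (m : ℝ) + 1 := by positivity
  push_cast at hβ
  have hlt1 : ((m : ℝ) + 1 - 1) / (m + 1) < 1 := by rw [div_lt_one hmpos]; linarith
  obtain ⟨γ, hγl, hγr⟩ := exists_between (lt_min hβ hlt1)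
  have hγ0 : 0 ≤ γ := le_trans (by rw [add_sub_cancel_right]; positivity) hγl.le
  have hγβ : γ < β := hγr.trans_le (min_le_left _ _)
  have hγ1 : γ < 1 := hγr.trans_le (min_le_right _ _)
  obtain ⟨C, hC, hsum⟩ := exists_sum_tail_le_rpow hF hγ0 hγβ hγ1
  have hexp : 0 < γ * (m + 1) - m := by
    rw [div_lt_iff₀ hmpos] at hγl; linarith
  have hlim : Tendsto (fun N : ℕ => (N : ℝ) ^ (γ * (m + 1) - m) / C ^ (m + 1)) atTop atTop :=
    ((tendsto_rpow_atTop hexp).comp tendsto_natCast_atTop_atTop).atTop_div_const (by positivity)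
  obtain ⟨N, hN, hN1⟩ := ((hlim.eventually_gt_atTop B).and (eventually_ge_atTop 1)).exists
  refine ⟨N, hN.trans_le ?_⟩
  have hNpos : (0 : ℝ) < N := by exact_mod_cast hN1
  have hU : (N : ℝ) ^ γ / C ≤ ∑ k ∈ Finset.range N, u k := by
    have h1 := natCast_le_sum_mul_sum_tail hu hrenew N
    have h2 : (N : ℝ) ≤ (∑ k ∈ Finset.range N, u k) * (C * (N : ℝ) ^ (1 - γ)) :=
      h1.trans (mul_le_mul_of_nonneg_left (hsum N) (Finset.sum_nonneg fun k _ => hu k))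
    rw [div_le_iff₀ hC]
    have h3 : (N : ℝ) ^ γ * (N : ℝ) ^ (1 - γ) = N := by
      rw [← Real.rpow_add hNpos]; simp
    have h4 : 0 < (N : ℝ) ^ (1 - γ) := by positivity
    refine le_of_mul_le_mul_right ?_ h4
    rw [h3]; linarith
  have hpm := pow_sum_div_card_le_sum_pow (s := Finset.range N) (f := u) (fun i _ => hu i) m
  rw [Finset.card_range] at hpm
  refine le_trans ?_ hpm
  calc (N : ℝ) ^ (γ * (m + 1) - m) / C ^ (m + 1)
      = ((N : ℝ) ^ γ / C) ^ (m + 1) / (N : ℝ) ^ m := by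
        rw [Real.rpow_sub hNpos, Real.rpow_natCast, Real.rpow_mul hNpos.le, div_pow]
        rw [show ((m : ℝ) + 1) = ((m + 1 : ℕ) : ℝ) by push_cast; ring, Real.rpow_natCast]
        field_simp
    _ ≤ _ := by gcongr

section Ergodic

variable {X : Type*}

/-- The maximum of `0` and of the first `n` Birkhoff sums of `f`. -/
def birkhoffMax (T : X → X) (f : X → ℝ) : ℕ → X → ℝ
  | 0, _ => 0
  | n + 1, x => max 0 (f x + birkhoffMax T f n (T x))

lemma birkhoffMax_nonneg (T : X → X) (f : X → ℝ) (n : ℕ) (x : X) : 0 ≤ birkhoffMax T f n x := by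
  cases n with
  | zero => exact le_rfl
  | succ n => exact le_max_left _ _

lemma birkhoffMax_le_succ (T : X → X) (f : X → ℝ) (n : ℕ) (x : X) :
    birkhoffMax T f n x ≤ birkhoffMax T f (n + 1) x := by
  induction n generalizing x with
  | zero => exact birkhoffMax_nonneg T f 1 x
  | succ n ih => exact max_le_max le_rfl (by gcongr; exact ih _)

lemma birkhoffSum_le_birkhoffMax (T : X → X) (f : X → ℝ) (n : ℕ) (x : X) :
    birkhoffSum T f n x ≤ birkhoffMax T f n x := by
  induction n generalizing x with
  | zero => simp [birkhoffMax]
  | succ n ih =>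
    rw [birkhoffSum_succ']
    exact le_trans (by gcongr; exact ih _) (le_max_right _ _)

lemma birkhoffMax_sub_le (T : X → X) (f : X → ℝ) (n : ℕ) {x : X} (hx : 0 < birkhoffMax T f n x) :
    birkhoffMax T f n x - birkhoffMax T f n (T x) ≤ f x := by
  cases n with
  | zero => exact absurd hx (lt_irrefl _)
  | succ n =>
    have h1 : birkhoffMax T f (n + 1) x = f x + birkhoffMax T f n (T x) := by
      rw [birkhoffMax] at hx ⊢
      exact max_eq_right (by by_contra! h; rw [max_eq_left h.le] at hx; exact lt_irrefl _ hx)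
    linarith [birkhoffMax_le_succ T f n (T x)]

variable [MeasurableSpace X] {ν : Measure X} {T : X → X} {f : X → ℝ}

lemma measurable_birkhoffMax (hT : Measurable T) (hf : Measurable f) (n : ℕ) :
    Measurable (birkhoffMax T f n) := by
  induction n with
  | zero => exact measurable_const
  | succ n ih => exact measurable_const.max (hf.add (ih.comp hT))

lemma integrable_birkhoffMax (hT : MeasurePreserving T ν ν) (hf : Integrable f ν)
    (n : ℕ) : Integrable (birkhoffMax T f n) ν := by
  induction n with
  | zero => exact integrable_zero _ _ _
  | succ n ih =>
    exact (integrable_zero X ℝ ν).sup (hf.add (hT.integrable_comp_of_integrable ih))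

/-- **Maximal ergodic inequality**. -/
lemma setIntegral_birkhoffMax_pos_nonneg (hT : MeasurePreserving T ν ν) (hfm : Measurable f)
    (hf : Integrable f ν) (n : ℕ) : 0 ≤ ∫ x in {x | 0 < birkhoffMax T f n x}, f x ∂ν := by
  have hM := integrable_birkhoffMax hT hf n
  have hMT : Integrable (fun x => birkhoffMax T f n (T x)) ν := hT.integrable_comp_of_integrable hM
  have hmeas : MeasurableSet {x | 0 < birkhoffMax T f n x} :=
    measurableSet_lt measurable_const (measurable_birkhoffMax hT.measurable hfm n)
  have h1 : ∫ x, birkhoffMax T f n (T x) ∂ν = ∫ x, birkhoffMax T f n x ∂ν := by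
    rw [← integral_map hT.measurable.aemeasurable (by rw [hT.map_eq]; exact hM.1), hT.map_eq]
  have h2 : ∫ x in {x | 0 < birkhoffMax T f n x}, birkhoffMax T f n x ∂ν
      = ∫ x, birkhoffMax T f n x ∂ν := by
    refine setIntegral_eq_integral_of_forall_compl_eq_zero fun x hx => ?_
    exact le_antisymm (not_lt.1 hx) (birkhoffMax_nonneg T f n x)
  have h3 : ∫ x in {x | 0 < birkhoffMax T f n x}, birkhoffMax T f n (T x) ∂ν
      ≤ ∫ x, birkhoffMax T f n (T x) ∂ν :=
    setIntegral_le_integral hMT (Eventually.of_forall fun x => birkhoffMax_nonneg T f n (T x))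
  calc (0 : ℝ) ≤ ∫ x in {x | 0 < birkhoffMax T f n x}, birkhoffMax T f n x ∂ν
        - ∫ x in {x | 0 < birkhoffMax T f n x}, birkhoffMax T f n (T x) ∂ν := by linarith
    _ = ∫ x in {x | 0 < birkhoffMax T f n x}, (birkhoffMax T f n x - birkhoffMax T f n (T x)) ∂ν :=
        (integral_sub hM.integrableOn hMT.integrableOn).symm
    _ ≤ _ := setIntegral_mono_on (hM.sub hMT).integrableOn hf.integrableOn hmeas
        fun x hx => birkhoffMax_sub_le T f n hx

lemma integral_nonneg_of_ae_exists_birkhoffSum_pos (hT : MeasurePreserving T ν ν)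
    (hfm : Measurable f) (hf : Integrable f ν) (h : ∀ᵐ x ∂ν, ∃ n, 0 < birkhoffSum T f n x) :
    0 ≤ ∫ x, f x ∂ν := by
  have hmeas : ∀ n, MeasurableSet {x | 0 < birkhoffMax T f n x} := fun n =>
    measurableSet_lt measurable_const (measurable_birkhoffMax hT.measurable hfm n)
  have hmono : Monotone fun n => {x | 0 < birkhoffMax T f n x} :=
    monotone_nat_of_le_succ fun n x hx => lt_of_lt_of_le hx (birkhoffMax_le_succ T f n x)
  have hlim := tendsto_setIntegral_of_monotone hmeas hmono (hf.integrableOn (μ := ν))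
  have hU : ∫ x in ⋃ n, {x | 0 < birkhoffMax T f n x}, f x ∂ν = ∫ x, f x ∂ν := by
    have hset : (⋃ n, {x | 0 < birkhoffMax T f n x} : Set X) =ᵐ[ν] Set.univ := by
      refine eventuallyEq_univ.2 ?_
      filter_upwards [h] with x ⟨n, hn⟩
      exact Set.mem_iUnion.2 ⟨n, hn.trans_le (birkhoffSum_le_birkhoffMax T f n x)⟩
    rw [setIntegral_congr_set hset, setIntegral_univ]
  rw [hU] at hlim
  exact ge_of_tendsto' hlim fun n => setIntegral_birkhoffMax_pos_nonneg hT hfm hf n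

lemma measurable_birkhoffAverage (hT : Measurable T) (hf : Measurable f) (n : ℕ) :
    Measurable (birkhoffAverage ℝ T f n) := by
  have h : Measurable fun x => ∑ k ∈ Finset.range n, f (T^[k] x) :=
    Finset.measurable_fun_sum _ fun k _ => hf.comp (hT.iterate k)
  exact h.const_smul (n : ℝ)⁻¹

lemma ae_eventually_birkhoffAverage_lt [IsProbabilityMeasure ν] (hT : Ergodic T ν)
    (hfm : Measurable f) {K : ℝ} (hK : ∀ x, |f x| ≤ K) {α : ℝ} (hα : ∫ x, f x ∂ν < α) :
    ∀ᵐ x ∂ν, ∀ᶠ n in atTop, birkhoffAverage ℝ T f n x < α := by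
  have hTp : MeasurePreserving T ν ν := hT.toMeasurePreserving
  obtain ⟨a, ha, haα⟩ := exists_between hα
  have hfi : Integrable f ν := .of_bound hfm.aestronglyMeasurable K (Eventually.of_forall hK)
  let E : Set X := {x | ∃ j : ℕ, ∃ᶠ n in atTop, a + 1 / ((j : ℝ) + 1) < birkhoffAverage ℝ T f n x}
  have hE : MeasurableSet E := by
    have : E = ⋃ j : ℕ, limsup (fun n => {x | a + 1 / ((j : ℝ) + 1) < birkhoffAverage ℝ T f n x})
        atTop := by
      ext x; simp [E, mem_limsup_iff_frequently_mem]
    rw [this]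
    exact .iUnion fun j => .measurableSet_limsup fun n =>
      measurableSet_lt measurable_const (measurable_birkhoffAverage hT.measurable hfm n)
  have hbdd : Bornology.IsBounded (Set.range f) :=
    isBounded_iff_forall_norm_le.2 ⟨K, by rintro _ ⟨x, rfl⟩; exact hK x⟩
  have hclose := tendsto_birkhoffAverage_apply_sub_birkhoffAverage' ℝ hbdd T
  have hstep : ∀ (u v : ℕ → ℝ), Tendsto (fun n => u n - v n) atTop (𝓝 0) →
      (∃ j : ℕ, ∃ᶠ n in atTop, a + 1 / ((j : ℝ) + 1) < u n) →
      ∃ j : ℕ, ∃ᶠ n in atTop, a + 1 / ((j : ℝ) + 1) < v n := by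
    rintro u v huv ⟨j, hj⟩
    have hlt : 1 / (((j + 1 : ℕ) : ℝ) + 1) < 1 / ((j : ℝ) + 1) := by
      apply one_div_lt_one_div_of_lt (by positivity); push_cast; linarith
    refine ⟨j + 1, ?_⟩
    have hev := huv.eventually (gt_mem_nhds (sub_pos.2 hlt))
    exact (hj.and_eventually hev).mono fun n hn => by linarith [hn.1, hn.2]
  have hinv : T ⁻¹' E = E := by
    ext x
    refine ⟨hstep _ _ (hclose x), hstep _ _ ?_⟩
    simpa using (hclose x).neg
  rcases hT.toPreErgodic.ae_mem_or_ae_notMem hE hinv with h | h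
  · exfalso
    have hpos : ∀ᵐ x ∂ν, ∃ n, 0 < birkhoffSum T (fun y => f y - a) n x := by
      filter_upwards [h] with x ⟨j, hj⟩
      obtain ⟨n, hn, hn1⟩ := (hj.and_eventually (eventually_ge_atTop 1)).exists
      refine ⟨n, ?_⟩
      have hn0 : (0 : ℝ) < n := by exact_mod_cast hn1
      have hj0 : (0 : ℝ) < 1 / ((j : ℝ) + 1) := by positivity
      have hsum : birkhoffSum T (fun y => f y - a) n x = birkhoffSum T f n x - n * a := by
        simp [birkhoffSum, Finset.sum_sub_distrib]
      have h1 : a < (n : ℝ)⁻¹ * birkhoffSum T f n x := by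
        have : a + 1 / ((j : ℝ) + 1) < (n : ℝ)⁻¹ * birkhoffSum T f n x := hn
        linarith
      rw [hsum, sub_pos]
      rwa [inv_mul_eq_div, lt_div_iff₀ hn0, mul_comm] at h1
    have := integral_nonneg_of_ae_exists_birkhoffSum_pos hTp (hfm.sub_const a)
      (hfi.sub (integrable_const a)) hpos
    rw [integral_sub hfi (integrable_const a)] at this
    simp at this
    linarith
  · filter_upwards [h] with x hx
    obtain ⟨j, hj⟩ := exists_nat_one_div_lt (sub_pos.2 haα)
    by_contra hcon
    refine hx ⟨j, ?_⟩
    rw [not_eventually] at hcon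
    exact hcon.mono fun n hn => by linarith [not_lt.1 hn]

/-- **Birkhoff's pointwise ergodic theorem** for bounded functions and ergodic maps. -/
lemma ae_tendsto_birkhoffAverage [IsProbabilityMeasure ν] (hT : Ergodic T ν)
    (hfm : Measurable f) {K : ℝ} (hK : ∀ x, |f x| ≤ K) :
    ∀ᵐ x ∂ν, Tendsto (birkhoffAverage ℝ T f · x) atTop (𝓝 (∫ x, f x ∂ν)) := by
  have hup : ∀ j : ℕ, ∀ᵐ x ∂ν, ∀ᶠ n in atTop,
      birkhoffAverage ℝ T f n x < ∫ x, f x ∂ν + 1 / ((j : ℝ) + 1) := fun j =>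
    ae_eventually_birkhoffAverage_lt hT hfm hK (lt_add_of_pos_right _ (by positivity))
  have hlo : ∀ j : ℕ, ∀ᵐ x ∂ν, ∀ᶠ n in atTop,
      birkhoffAverage ℝ T (fun y => - f y) n x < ∫ x, - f x ∂ν + 1 / ((j : ℝ) + 1) := fun j =>
    ae_eventually_birkhoffAverage_lt hT hfm.neg (K := K) (by simpa using hK)
      (lt_add_of_pos_right _ (by positivity))
  filter_upwards [ae_all_iff.2 hup, ae_all_iff.2 hlo] with x h1 h2
  rw [Metric.tendsto_nhds]
  intro ε hε
  obtain ⟨j, hj⟩ := exists_nat_one_div_lt hε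
  filter_upwards [h1 j, h2 j] with n hn1 hn2
  have hneg : birkhoffAverage ℝ T (fun y => - f y) n x = - birkhoffAverage ℝ T f n x := by
    simp [birkhoffAverage, birkhoffSum]
  rw [hneg, integral_neg] at hn2
  rw [Real.dist_eq, abs_lt]
  constructor <;> linarith

end Ergodic

section Shift

variable {α : Type*}

/-- The one-sided shift of sequences. -/
def seqShift (x : ℕ → α) : ℕ → α := fun k => x (k + 1)

lemma seqShift_iterate (n : ℕ) (x : ℕ → α) (k : ℕ) : seqShift^[n] x k = x (k + n) := by
  induction n generalizing x with
  | zero => rfl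
  | succ n ih => rw [Function.iterate_succ_apply, ih, seqShift]; congr 1

variable [MeasurableSpace α]

lemma measurable_seqShift : Measurable (seqShift (α := α)) :=
  measurable_pi_lambda _ fun _ => measurable_pi_apply _

/-- The one-sided Bernoulli shift is ergodic. -/
lemma ergodic_seqShift (G : Measure α) [IsProbabilityMeasure G] :
    Ergodic (seqShift (α := α)) (Measure.infinitePi fun _ : ℕ => G) := by
  have hmp : MeasurePreserving (seqShift (α := α)) (Measure.infinitePi fun _ : ℕ => G)
      (Measure.infinitePi fun _ : ℕ => G) :=
    ⟨measurable_seqShift, Measure.map_infinitePi_infinitePi_of_inj (P := fun _ : ℕ => G)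
      (add_left_injective 1)⟩
  refine ⟨hmp, ⟨fun A hA hinv => ?_⟩⟩
  let s : ℕ → MeasurableSpace (ℕ → α) := fun k => MeasurableSpace.comap (fun x => x k) inferInstance
  have hind : iIndep s (Measure.infinitePi fun _ : ℕ => G) :=
    iIndepFun_infinitePi (P := fun _ : ℕ => G) (X := fun _ x => x) fun _ => measurable_id
  have htail : MeasurableSet[limsup s atTop] A := by
    rw [limsup_eq_iInf_iSup_of_nat, MeasurableSpace.measurableSet_iInf]
    intro n
    have hAn : seqShift^[n] ⁻¹' A = A := Function.IsFixedPt.preimage_iterate hinv n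
    rw [← hAn]
    refine (?_ : Measurable[⨆ i, ⨆ (_ : i ≥ n), s i] (seqShift^[n] : (ℕ → α) → ℕ → α)) hA
    refine (@measurable_pi_iff _ _ _ (⨆ i, ⨆ (_ : i ≥ n), s i) _ _).2 fun k => ?_
    simp only [seqShift_iterate]
    refine Measurable.mono (comap_measurable (fun x : ℕ → α => x (k + n))) ?_ le_rfl
    exact le_iSup₂_of_le (k + n) (Nat.le_add_left n k) le_rfl
  have h01 := measure_zero_or_one_of_measurableSet_limsup_atTop
    (fun k => (measurable_pi_apply k).comap_le) hind htail
  rw [eventuallyConst_set]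
  rcases h01 with h | h
  · exact Or.inr (measure_eq_zero_iff_ae_notMem.1 h)
  · exact Or.inl ((mem_ae_iff_prob_eq_one hA).2 h)

end Shift

section Deterministic

variable {ι : Type*}

/-- The simultaneous renewal times of the renewal sequences with epochs `x (i, 0), x (i, 1), …`. -/
def renewalSet (x : ι × ℕ → ℕ) : Set ℕ := {n | ∀ i, ∃ t, ∑ k ∈ Finset.range t, x (i, k) = n}

/-- The part of `C` from `n` on, seen from `n`. -/
def fromPoint (n : ℕ) (C : Set ℕ) : Set ℕ := {k | n + k ∈ C}

/-- `n` is the least positive point of `C`. -/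
def IsFirst (n : ℕ) (C : Set ℕ) : Prop := 0 < n ∧ n ∈ C ∧ ∀ k, 0 < k → k < n → k ∉ C

/-- Dropping the first `t i` epochs of the `i`-th sequence. -/
def dropEpochs (t : ι → ℕ) (x : ι × ℕ → ℕ) : ι × ℕ → ℕ := fun p => x (p.1, t p.1 + p.2)

/-- The first positive simultaneous renewal time is `n`, and it is reached by the `i`-th sequence
in exactly `t i` steps. The condition only involves the first `t i` epochs of that sequence. -/
def firstAt (n : ℕ) (t : ι → ℕ) : Set (ι × ℕ → ℕ) :=
  {x | 0 < n ∧ (∀ i, ∀ k < t i, 0 < x (i, k)) ∧ (∀ i, ∑ k ∈ Finset.range (t i), x (i, k) = n) ∧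
    ∀ l, 0 < l → l < n → ∃ i, ∀ s < t i, ∑ k ∈ Finset.range s, x (i, k) ≠ l}

lemma zero_mem_renewalSet (x : ι × ℕ → ℕ) : 0 ∈ renewalSet x := fun _ => ⟨0, by simp⟩

lemma IsFirst.eq {n l : ℕ} {C : Set ℕ} (hn : IsFirst n C) (hl : IsFirst l C) : n = l := by
  rcases lt_trichotomy n l with h | h | h
  · exact absurd hn.2.1 (hl.2.2 n hn.1 h)
  · exact h
  · exact absurd hl.2.1 (hn.2.2 l hl.1 h)

lemma exists_isFirst {n : ℕ} {C : Set ℕ} (hn : 0 < n) (hC : n ∈ C) :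
    ∃ l, l ≤ n ∧ IsFirst l C := by
  classical
  have h : ∃ l, 0 < l ∧ l ∈ C := ⟨n, hn, hC⟩
  exact ⟨Nat.find h, Nat.find_min' h ⟨hn, hC⟩, (Nat.find_spec h).1, (Nat.find_spec h).2,
    fun k hk hlt hkC => Nat.find_min h hlt ⟨hk, hkC⟩⟩

lemma strictMono_sum_range {y : ℕ → ℕ} (hy : ∀ k, 0 < y k) :
    StrictMono fun t => ∑ k ∈ Finset.range t, y k :=
  strictMono_nat_of_lt_succ fun t => by
    rw [Finset.sum_range_succ]; exact Nat.lt_add_of_pos_right (hy t)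

lemma fromPoint_renewalSet {x : ι × ℕ → ℕ} (hx : ∀ p, 0 < x p) {n : ℕ} {t : ι → ℕ}
    (ht : ∀ i, ∑ k ∈ Finset.range (t i), x (i, k) = n) :
    fromPoint n (renewalSet x) = renewalSet (dropEpochs t x) := by
  ext l
  refine forall_congr' fun i => ?_
  have hmono := strictMono_sum_range fun k => hx (i, k)
  have hsplit : ∀ s, ∑ k ∈ Finset.range (t i + s), x (i, k)
      = n + ∑ k ∈ Finset.range s, dropEpochs t x (i, k) := fun s => by
    rw [Finset.sum_range_add, ht i]; rfl
  constructor
  · rintro ⟨s, hs⟩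
    have hle : t i ≤ s := hmono.le_iff_le.1 (by
      change ∑ k ∈ Finset.range (t i), x (i, k) ≤ ∑ k ∈ Finset.range s, x (i, k)
      rw [ht i, hs]; exact Nat.le_add_right n l)
    obtain ⟨r, rfl⟩ := Nat.exists_eq_add_of_le hle
    refine ⟨r, ?_⟩
    have := hsplit r
    omega
  · rintro ⟨r, hr⟩
    exact ⟨t i + r, by rw [hsplit, hr]⟩

lemma isFirst_renewalSet_iff {x : ι × ℕ → ℕ} (hx : ∀ p, 0 < x p) (n : ℕ) :
    IsFirst n (renewalSet x) ↔ ∃ t, x ∈ firstAt n t := by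
  constructor
  · rintro ⟨hn, hmem, hmin⟩
    choose t ht using hmem
    refine ⟨t, hn, fun i k _ => hx _, ht, fun l hl hln => ?_⟩
    have := hmin l hl hln
    simp only [renewalSet, Set.mem_ofPred_eq, not_forall, not_exists] at this
    obtain ⟨i, hi⟩ := this
    exact ⟨i, fun s _ => hi s⟩
  · rintro ⟨t, hn, -, ht, hmin⟩
    refine ⟨hn, fun i => ⟨t i, ht i⟩, fun l hl hln hmem => ?_⟩
    obtain ⟨i, hi⟩ := hmin l hl hln
    obtain ⟨s, hs⟩ := hmem i
    refine hi s ?_ hs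
    refine (strictMono_sum_range fun k => hx (i, k)).lt_iff_lt.1 ?_
    change ∑ k ∈ Finset.range s, x (i, k) < ∑ k ∈ Finset.range (t i), x (i, k)
    rwa [ht i, hs]

lemma firstAt_congr {n : ℕ} {t : ι → ℕ} {x y : ι × ℕ → ℕ}
    (h : ∀ p : ι × ℕ, p.2 < t p.1 → x p = y p) (hx : x ∈ firstAt n t) : y ∈ firstAt n t := by
  have hsum : ∀ i, ∀ s ≤ t i, ∑ k ∈ Finset.range s, x (i, k) = ∑ k ∈ Finset.range s, y (i, k) :=
    fun i s hs => Finset.sum_congr rfl fun k hk =>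
      h (i, k) (lt_of_lt_of_le (Finset.mem_range.1 hk) hs)
  obtain ⟨hn, hpos, hend, hmin⟩ := hx
  refine ⟨hn, fun i k hk => h (i, k) hk ▸ hpos i k hk, fun i => hsum i _ le_rfl ▸ hend i,
    fun l hl hln => ?_⟩
  obtain ⟨i, hi⟩ := hmin l hl hln
  exact ⟨i, fun s hs => hsum i s hs.le ▸ hi s hs⟩

lemma firstAt_disjoint {n : ℕ} {s t : ι → ℕ} {x : ι × ℕ → ℕ} (hs : x ∈ firstAt n s)
    (ht : x ∈ firstAt n t) : s = t := by
  have key : ∀ s t : ι → ℕ, x ∈ firstAt n s → x ∈ firstAt n t → ∀ i, s i ≤ t i := by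
    intro s t hs ht i
    by_contra! hlt
    have h1 := hs.2.2.1 i
    have h2 := ht.2.2.1 i
    have h3 : ∑ k ∈ Finset.range (t i), x (i, k) < ∑ k ∈ Finset.range (s i), x (i, k) :=
      Finset.sum_lt_sum_of_subset (Finset.range_mono hlt.le) (Finset.mem_range.2 hlt)
        (by simp) (hs.2.1 i _ hlt) fun _ _ _ => Nat.zero_le _
    omega
  exact funext fun i => le_antisymm (key s t hs ht i) (key t s ht hs i)

end Deterministic

section Measurability

lemma measurable_fromPoint (n : ℕ) : Measurable (fromPoint n) :=
  measurable_set_iff.2 fun k => measurable_set_mem (n + k)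

lemma measurableSet_isFirst (n : ℕ) : MeasurableSet {C : Set ℕ | IsFirst n C} := by
  have : {C : Set ℕ | IsFirst n C}
      = {_C : Set ℕ | 0 < n} ∩ ({C | n ∈ C} ∩ ⋂ k, ⋂ (_ : 0 < k), ⋂ (_ : k < n), {C | k ∉ C}) := by
    ext C; simp [IsFirst]
  rw [this]
  exact (MeasurableSet.const _).inter ((measurableSet_mem n).inter
    (.iInter fun k => .iInter fun _ => .iInter fun _ => measurableSet_notMem k))

lemma measurable_renewalSet {ι : Type*} [Countable ι] :
    Measurable (renewalSet : (ι × ℕ → ℕ) → Set ℕ) := by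
  refine measurable_set_iff.2 fun n => ?_
  refine Measurable.forall fun i => Measurable.exists fun t => ?_
  have h : Measurable fun x : ι × ℕ → ℕ => ∑ k ∈ Finset.range t, x (i, k) :=
    Finset.measurable_fun_sum _ fun k _ => measurable_pi_apply _
  exact h.eq_const n

end Measurability

section Independence

variable {Ω : Type*} [MeasurableSpace Ω] {μ : Measure Ω}

lemma indepFun_comp_of_disjoint {κ a b : Type*} {ξ : κ → Ω → ℕ} (hm : ∀ p, Measurable (ξ p))
    (hind : iIndepFun ξ μ) (A : Set κ) {f : a → κ} {g : b → κ} (hf : ∀ i, f i ∈ A)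
    (hg : ∀ j, g j ∉ A) : IndepFun (fun ω i => ξ (f i) ω) (fun ω j => ξ (g j) ω) μ := by
  have h := indep_iSup_of_disjoint (fun p => (hm p).comap_le) hind (disjoint_compl_right (a := A))
  rw [IndepFun_iff_Indep]
  refine indep_of_indep_of_le_left (indep_of_indep_of_le_right h ?_) ?_
  · rw [← measurable_iff_comap_le]
    refine (@measurable_pi_iff _ _ _ (_) _ _).2 fun j => ?_
    exact (comap_measurable (ξ (g j))).mono (le_iSup₂_of_le (g j) (hg j) le_rfl) le_rfl
  · rw [← measurable_iff_comap_le]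
    refine (@measurable_pi_iff _ _ _ (_) _ _).2 fun i => ?_
    exact (comap_measurable (ξ (f i))).mono (le_iSup₂_of_le (f i) (hf i) le_rfl) le_rfl

lemma map_comp_eq_infinitePi {κ a : Type*} {F : Measure ℕ} {ξ : κ → Ω → ℕ}
    (hm : ∀ p, Measurable (ξ p)) (hind : iIndepFun ξ μ) (hlaw : ∀ p, μ.map (ξ p) = F)
    {g : a → κ} (hg : g.Injective) :
    μ.map (fun ω j => ξ (g j) ω) = Measure.infinitePi fun _ : a => F := by
  rw [(hind.precomp hg).map_fun_eq_infinitePi_map fun j => hm (g j)]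
  simp_rw [hlaw]

lemma ae_pos_of_law {F : Measure ℕ} (hF0 : F {0} = 0) {κ : Type*} [Countable κ] {ξ : κ → Ω → ℕ}
    (hm : ∀ p, Measurable (ξ p)) (hlaw : ∀ p, μ.map (ξ p) = F) : ∀ᵐ ω ∂μ, ∀ p, 0 < ξ p ω := by
  rw [ae_all_iff]
  intro p
  have h : μ (ξ p ⁻¹' {0}) = 0 := by
    rw [← Measure.map_apply (hm p) (measurableSet_singleton 0), hlaw p, hF0]
  filter_upwards [measure_eq_zero_iff_ae_notMem.1 h] with ω hω
  exact Nat.pos_of_ne_zero hω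

variable {ι : Type*} [Fintype ι] {F : Measure ℕ} {ξ : ι × ℕ → Ω → ℕ}

lemma measurable_renewalSet_comp (hm : ∀ p, Measurable (ξ p)) :
    Measurable fun ω => renewalSet fun p => ξ p ω :=
  measurable_renewalSet.comp (measurable_pi_iff.2 hm)

lemma measure_firstAt_inter (hm : ∀ p, Measurable (ξ p)) (hind : iIndepFun ξ μ)
    (hlaw : ∀ p, μ.map (ξ p) = F) (n : ℕ) (t : ι → ℕ) {B : Set (Set ℕ)} (hB : MeasurableSet B) :
    MeasurableSet {ω | (fun p => ξ p ω) ∈ firstAt n t} ∧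
    μ ({ω | (fun p => ξ p ω) ∈ firstAt n t} ∩
        {ω | renewalSet (dropEpochs t fun p => ξ p ω) ∈ B})
      = μ {ω | (fun p => ξ p ω) ∈ firstAt n t} * μ {ω | renewalSet (fun p => ξ p ω) ∈ B} := by
  classical
  let A : Set (ι × ℕ) := {p | p.2 < t p.1}
  have hA : A.Finite := by
    refine (Set.finite_univ (α := Σ i : ι, Fin (t i))).image (fun q => (q.1, (q.2 : ℕ)))
      |>.subset ?_
    rintro ⟨i, k⟩ hk
    exact ⟨⟨i, ⟨k, hk⟩⟩, trivial, rfl⟩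
  have : Finite A := hA
  let ext : (A → ℕ) → ι × ℕ → ℕ := fun y p => if h : p ∈ A then y ⟨p, h⟩ else 0
  let X₁ : Ω → A → ℕ := fun ω p => ξ p ω
  let g : ι × ℕ → ι × ℕ := fun p => (p.1, t p.1 + p.2)
  have hg : g.Injective := by
    rintro ⟨i, k⟩ ⟨j, l⟩ h
    simp only [g, Prod.mk.injEq] at h
    obtain ⟨rfl, h⟩ := h
    simpa using h
  have hX₁ : Measurable X₁ := measurable_pi_iff.2 fun p => hm p
  have hX₂ : Measurable fun ω p => ξ (g p) ω := measurable_pi_iff.2 fun p => hm (g p)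
  have hfirst : {ω | (fun p => ξ p ω) ∈ firstAt n t} = X₁ ⁻¹' {y | ext y ∈ firstAt n t} := by
    ext ω
    have hagree : ∀ p : ι × ℕ, p.2 < t p.1 → ξ p ω = ext (X₁ ω) p := fun p hp => by
      simp only [ext, X₁, show p ∈ A from hp, dite_true]
    exact ⟨fun h => firstAt_congr hagree h, fun h => firstAt_congr (fun p hp => (hagree p hp).symm) h⟩
  have hS : MeasurableSet {y | ext y ∈ firstAt n t} := Set.to_countable _ |>.measurableSet
  have hindep : IndepFun X₁ (fun ω p => ξ (g p) ω) μ :=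
    indepFun_comp_of_disjoint hm hind A (f := fun p : A => (p : ι × ℕ)) (g := g)
      (fun p => p.2) fun p => by simp [A, g]
  have hR : MeasurableSet (renewalSet ⁻¹' B : Set (ι × ℕ → ℕ)) := measurable_renewalSet hB
  refine ⟨hfirst ▸ hX₁ hS, ?_⟩
  have h := hindep.measure_inter_preimage_eq_mul _ _ hS hR
  rw [← hfirst] at h
  have hl : μ ((fun ω p => ξ (g p) ω) ⁻¹' (renewalSet ⁻¹' B))
      = μ {ω | renewalSet (fun p => ξ p ω) ∈ B} := by
    rw [← Measure.map_apply hX₂ hR, map_comp_eq_infinitePi hm hind hlaw hg,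
      ← map_comp_eq_infinitePi hm hind hlaw Function.injective_id,
      Measure.map_apply (measurable_pi_iff.2 fun p => hm (id p)) hR]
    rfl
  rw [hl] at h
  exact h

/-- **Regeneration**: seen from its first positive point, the set of simultaneous renewal times is
a copy of itself which is independent of that point. -/
lemma measure_isFirst_inter_fromPoint (hF0 : F {0} = 0) (hm : ∀ p, Measurable (ξ p))
    (hind : iIndepFun ξ μ) (hlaw : ∀ p, μ.map (ξ p) = F) (n : ℕ) {B : Set (Set ℕ)}
    (hB : MeasurableSet B) :
    μ {ω | IsFirst n (renewalSet fun p => ξ p ω) ∧ fromPoint n (renewalSet fun p => ξ p ω) ∈ B}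
      = μ {ω | IsFirst n (renewalSet fun p => ξ p ω)} *
        μ {ω | renewalSet (fun p => ξ p ω) ∈ B} := by
  have key : ∀ B : Set (Set ℕ), MeasurableSet B →
      μ {ω | IsFirst n (renewalSet fun p => ξ p ω) ∧ fromPoint n (renewalSet fun p => ξ p ω) ∈ B}
      = (∑' t : ι → ℕ, μ {ω | (fun p => ξ p ω) ∈ firstAt n t}) *
        μ {ω | renewalSet (fun p => ξ p ω) ∈ B} := by
    intro B hB
    have hae : {ω | IsFirst n (renewalSet fun p => ξ p ω) ∧
        fromPoint n (renewalSet fun p => ξ p ω) ∈ B} =ᵐ[μ]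
        ⋃ t : ι → ℕ, {ω | (fun p => ξ p ω) ∈ firstAt n t} ∩
          {ω | renewalSet (dropEpochs t fun p => ξ p ω) ∈ B} := by
      filter_upwards [ae_pos_of_law hF0 hm hlaw] with ω hω
      refine propext ?_
      change (IsFirst n _ ∧ _) ↔ ω ∈ ⋃ t : ι → ℕ, _
      rw [Set.mem_iUnion, isFirst_renewalSet_iff hω]
      constructor
      · rintro ⟨⟨t, ht⟩, h⟩
        rw [fromPoint_renewalSet hω ht.2.2.1] at h
        exact ⟨t, ht, h⟩
      · rintro ⟨t, ht, h⟩
        refine ⟨⟨t, ht⟩, ?_⟩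
        rw [fromPoint_renewalSet hω ht.2.2.1]
        exact h
    rw [measure_congr hae, measure_iUnion]
    · rw [← ENNReal.tsum_mul_right]
      exact tsum_congr fun t => (measure_firstAt_inter hm hind hlaw n t hB).2
    · intro s t hst
      refine Set.disjoint_left.2 fun ω hs ht => hst
        (firstAt_disjoint (n := n) (x := fun p => ξ p ω) hs.1 ht.1)
    · intro t
      refine (measure_firstAt_inter hm hind hlaw n t hB).1.inter ?_
      exact (measurable_renewalSet.comp (measurable_pi_iff.2 fun p => hm _)) hB
  have huniv := key Set.univ MeasurableSet.univ
  have := hind.isProbabilityMeasure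
  simp only [Set.mem_univ, and_true, Set.ofPred_true, measure_univ, mul_one] at huniv
  rw [key B hB, huniv]

end Independence

section RenewalMass

variable {Ω : Type*} [MeasurableSpace Ω] {μ : Measure Ω} {F : Measure ℕ} {ξ : ℕ → Ω → ℕ}

lemma measurable_sum_range (hm : ∀ k, Measurable (ξ k)) (t : ℕ) :
    Measurable fun ω => ∑ k ∈ Finset.range t, ξ k ω :=
  Finset.measurable_fun_sum _ fun k _ => hm k

lemma measure_exists_sum_eq (hF0 : F {0} = 0) (hm : ∀ k, Measurable (ξ k))
    (hlaw : ∀ k, μ.map (ξ k) = F) (n : ℕ) :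
    μ {ω | ∃ t, ∑ k ∈ Finset.range t, ξ k ω = n}
      = ∑' t, μ {ω | ∑ k ∈ Finset.range t, ξ k ω = n} := by
  have : {ω | ∃ t, ∑ k ∈ Finset.range t, ξ k ω = n}
      = ⋃ t, {ω | ∑ k ∈ Finset.range t, ξ k ω = n} := by ext; simp
  rw [this, measure_iUnion₀]
  · intro s t hst
    refine measure_eq_zero_iff_ae_notMem.2 ?_
    filter_upwards [ae_pos_of_law hF0 hm hlaw] with ω hω
    rintro ⟨h1, h2⟩
    exact hst ((strictMono_sum_range hω).injective ((h1 : _ = n).trans (h2 : _ = n).symm))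
  · exact fun t => (measurable_sum_range hm t (measurableSet_singleton n)).nullMeasurableSet

/-- Decomposition at the last renewal time up to `n`. -/
lemma one_le_sum_renewalMass_mul_tail [IsProbabilityMeasure μ] [IsProbabilityMeasure F]
    (hF0 : F {0} = 0) (hm : ∀ k, Measurable (ξ k)) (hind : iIndepFun ξ μ)
    (hlaw : ∀ k, μ.map (ξ k) = F) (n : ℕ) :
    1 ≤ ∑ k ∈ Finset.range (n + 1),
      μ.real {ω | ∃ t, ∑ j ∈ Finset.range t, ξ j ω = k} * tail F (n - k) := by
  have hk : ∀ k, μ {ω | ∃ t, ∑ j ∈ Finset.range t, ξ j ω = k ∧ n - k < ξ t ω}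
      ≤ μ {ω | ∃ t, ∑ j ∈ Finset.range t, ξ j ω = k} * F (Set.Ioi (n - k)) := by
    intro k
    have hset : {ω | ∃ t, ∑ j ∈ Finset.range t, ξ j ω = k ∧ n - k < ξ t ω}
        = ⋃ t, ((fun ω => ∑ j ∈ Finset.range t, ξ j ω) ⁻¹' {k} ∩ ξ t ⁻¹' Set.Ioi (n - k)) := by
      ext; simp
    rw [hset, measure_exists_sum_eq hF0 hm hlaw, ← ENNReal.tsum_mul_right]
    refine (measure_iUnion_le _).trans (ENNReal.tsum_le_tsum fun t => le_of_eq ?_)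
    have hi : IndepFun (fun ω => ∑ j ∈ Finset.range t, ξ j ω) (ξ t) μ := by
      have := hind.indepFun_sum_range_succ hm t
      convert this using 1
      ext ω; simp
    rw [hi.measure_inter_preimage_eq_mul _ _ (measurableSet_singleton k) measurableSet_Ioi,
      ← Measure.map_apply (hm t) measurableSet_Ioi, hlaw t]
    rfl
  have hcover : (1 : ENNReal) ≤ ∑ k ∈ Finset.range (n + 1),
      μ {ω | ∃ t, ∑ j ∈ Finset.range t, ξ j ω = k} * F (Set.Ioi (n - k)) := by
    calc (1 : ENNReal)
        = μ (⋃ k ∈ Finset.range (n + 1),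
            {ω | ∃ t, ∑ j ∈ Finset.range t, ξ j ω = k ∧ n - k < ξ t ω}) := by
          rw [← measure_univ (μ := μ)]
          refine measure_congr (eventuallyEq_univ.2 ?_).symm
          filter_upwards [ae_pos_of_law hF0 hm hlaw] with ω hω
          have hex : ∃ t, n < ∑ j ∈ Finset.range t, ξ j ω :=
            ⟨n + 1, (strictMono_sum_range hω).le_apply⟩
          obtain ⟨t, ht⟩ : ∃ t, Nat.find hex = t + 1 := Nat.exists_eq_succ_of_ne_zero fun h => by
            have := Nat.find_spec hex
            rw [h] at this
            simp at this
          have h1 : n < ∑ j ∈ Finset.range (t + 1), ξ j ω := ht ▸ Nat.find_spec hex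
          have h2 : ¬ n < ∑ j ∈ Finset.range t, ξ j ω := Nat.find_min hex (by omega)
          rw [Finset.sum_range_succ] at h1
          exact Set.mem_biUnion (x := ∑ j ∈ Finset.range t, ξ j ω)
            (Finset.mem_coe.2 (Finset.mem_range.2 (by omega))) ⟨t, rfl, by omega⟩
      _ ≤ _ := (measure_biUnion_finset_le _ _).trans (Finset.sum_le_sum fun k _ => hk k)
  have hfin : ∑ k ∈ Finset.range (n + 1),
      μ {ω | ∃ t, ∑ j ∈ Finset.range t, ξ j ω = k} * F (Set.Ioi (n - k)) ≠ ⊤ :=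
    ENNReal.sum_ne_top.2 fun k _ => ENNReal.mul_ne_top (measure_ne_top _ _) (measure_ne_top _ _)
  have h := ENNReal.toReal_mono hfin hcover
  rw [ENNReal.toReal_sum fun k _ =>
    ENNReal.mul_ne_top (measure_ne_top _ _) (measure_ne_top _ _)] at h
  simpa [ENNReal.toReal_mul, Measure.real, tail] using h

end RenewalMass

section Recurrence

variable {Ω : Type*} [MeasurableSpace Ω] {μ : Measure Ω} {ι : Type*} [Fintype ι] {F : Measure ℕ}
  {ξ : ι × ℕ → Ω → ℕ}

lemma measurableSet_isFirst_renewalSet (hm : ∀ p, Measurable (ξ p)) (n : ℕ) :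
    MeasurableSet {ω | IsFirst n (renewalSet fun p => ξ p ω)} :=
  measurable_renewalSet_comp hm (measurableSet_isFirst n)

lemma ae_fromPoint_mem (hF0 : F {0} = 0) (hm : ∀ p, Measurable (ξ p))
    (hind : iIndepFun ξ μ) (hlaw : ∀ p, μ.map (ξ p) = F) {B : Set (Set ℕ)} (hB : MeasurableSet B)
    (h : ∀ᵐ ω ∂μ, renewalSet (fun p => ξ p ω) ∈ B) :
    ∀ᵐ ω ∂μ, ∀ n, IsFirst n (renewalSet fun p => ξ p ω) →
      fromPoint n (renewalSet fun p => ξ p ω) ∈ B := by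
  rw [ae_all_iff]
  intro n
  have h0 := measure_isFirst_inter_fromPoint hF0 hm hind hlaw n hB.compl
  have h1 : μ {ω | renewalSet (fun p => ξ p ω) ∈ Bᶜ} = 0 := h
  rw [h1, mul_zero] at h0
  filter_upwards [measure_eq_zero_iff_ae_notMem.1 h0] with ω hω hfirst
  by_contra hcon
  exact hω ⟨hfirst, hcon⟩

lemma ae_exists_isFirst [IsProbabilityMeasure μ] (hF0 : F {0} = 0) (hm : ∀ p, Measurable (ξ p))
    (hind : iIndepFun ξ μ) (hlaw : ∀ p, μ.map (ξ p) = F)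
    (hdiv : ∀ B : ℝ, ∃ N, B <
      ∑ n ∈ Finset.range N, μ.real {ω | n ∈ renewalSet fun p => ξ p ω}) :
    ∀ᵐ ω ∂μ, ∃ n, IsFirst n (renewalSet fun p => ξ p ω) := by
  let C : Ω → Set ℕ := fun ω => renewalSet fun p => ξ p ω
  let v : ℕ → ℝ := fun n => μ.real {ω | n ∈ C ω}
  let f : ℕ → ℝ := fun n => μ.real {ω | IsFirst n (C ω)}
  have hmeas : MeasurableSet {ω | ∃ n, IsFirst n (C ω)} := by
    have : {ω | ∃ n, IsFirst n (C ω)} = ⋃ n, {ω | IsFirst n (C ω)} := by ext; simp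
    rw [this]
    exact .iUnion fun n => measurableSet_isFirst_renewalSet hm n
  have hrec : ∀ n, v (n + 1) ≤ ∑ k ∈ Finset.range (n + 1 + 1), f k * v (n + 1 - k) := by
    intro n
    have hsub : {ω | n + 1 ∈ C ω} ⊆ ⋃ k ∈ Finset.range (n + 1 + 1),
        {ω | IsFirst k (C ω) ∧ fromPoint k (C ω) ∈ {D | n + 1 - k ∈ D}} := by
      intro ω hω
      obtain ⟨k, hk, hfirst⟩ := exists_isFirst (Nat.succ_pos n) hω
      refine Set.mem_biUnion (x := k) (Finset.mem_coe.2 (Finset.mem_range.2 (by omega)))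
        ⟨hfirst, ?_⟩
      change k + (n + 1 - k) ∈ C ω
      rw [Nat.add_sub_cancel' hk]
      exact hω
    refine (measureReal_mono hsub (measure_ne_top _ _)).trans ((measureReal_biUnion_finset_le _ _).trans (le_of_eq ?_))
    refine Finset.sum_congr rfl fun k _ => ?_
    have := measure_isFirst_inter_fromPoint hF0 hm hind hlaw k (measurableSet_mem (n + 1 - k))
    rw [Measure.real, this, ENNReal.toReal_mul]
    rfl
  have hq : ∀ N, ∑ k ∈ Finset.range N, f k ≤ μ.real {ω | ∃ n, IsFirst n (C ω)} := by
    intro N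
    rw [← measureReal_biUnion_finset]
    · refine measureReal_mono fun ω hω => ?_
      simp only [Set.mem_iUnion] at hω
      obtain ⟨k, -, hk⟩ := hω
      exact ⟨k, hk⟩
    · exact fun k _ l _ hkl => Set.disjoint_left.2 fun ω h1 h2 => hkl (IsFirst.eq h1 h2)
    · exact fun k _ => measurableSet_isFirst_renewalSet hm k
  have hV : ∀ N, ∑ n ∈ Finset.range N, v n
      ≤ 1 + μ.real {ω | ∃ n, IsFirst n (C ω)} * ∑ n ∈ Finset.range N, v n := by
    intro N
    have hconv : ∑ n ∈ Finset.range N, v n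
        ≤ 1 + ∑ n ∈ Finset.range N, ∑ k ∈ Finset.range (n + 1), f k * v (n - k) := by
      cases N with
      | zero => simp
      | succ N =>
        rw [Finset.sum_range_succ', Finset.sum_range_succ' _ N, add_comm]
        have h1 : v 0 ≤ 1 := measureReal_le_one
        have h2 : 0 ≤ ∑ k ∈ Finset.range (0 + 1), f k * v (0 - k) :=
          Finset.sum_nonneg fun k _ => mul_nonneg measureReal_nonneg measureReal_nonneg
        have h3 := Finset.sum_le_sum fun n (_ : n ∈ Finset.range N) => hrec n
        linarith
    have h1 := sum_range_convolution_le (u := f) (w := v) (fun _ => measureReal_nonneg)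
      (fun _ => measureReal_nonneg) N
    have h2 : (∑ k ∈ Finset.range N, f k) * ∑ k ∈ Finset.range N, v k
        ≤ μ.real {ω | ∃ n, IsFirst n (C ω)} * ∑ n ∈ Finset.range N, v n :=
      mul_le_mul_of_nonneg_right (hq N) (Finset.sum_nonneg fun _ _ => measureReal_nonneg)
    linarith
  have hone : μ.real {ω | ∃ n, IsFirst n (C ω)} = 1 := by
    by_contra hne
    have hlt : μ.real {ω | ∃ n, IsFirst n (C ω)} < 1 := lt_of_le_of_ne measureReal_le_one hne
    obtain ⟨N, hN⟩ := hdiv (1 / (1 - μ.real {ω | ∃ n, IsFirst n (C ω)}))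
    rw [div_lt_iff₀ (sub_pos.2 hlt)] at hN
    have := hV N
    simp only [v, C] at this hN
    linarith
  exact (mem_ae_iff_prob_eq_one hmeas).2
    ((ENNReal.toReal_eq_one_iff _).1 hone)

/-- The simultaneous renewal times are almost surely infinite in number as soon as their expected
number is infinite. -/
lemma ae_infinite_renewalSet [IsProbabilityMeasure μ] (hF0 : F {0} = 0)
    (hm : ∀ p, Measurable (ξ p)) (hind : iIndepFun ξ μ) (hlaw : ∀ p, μ.map (ξ p) = F)
    (hdiv : ∀ B : ℝ, ∃ N, B <
      ∑ n ∈ Finset.range N, μ.real {ω | n ∈ renewalSet fun p => ξ p ω}) :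
    ∀ᵐ ω ∂μ, (renewalSet fun p => ξ p ω).Infinite := by
  have hmeas : ∀ k, MeasurableSet {C : Set ℕ | ∃ n, k ≤ n ∧ n ∈ C} := fun k => by
    have : {C : Set ℕ | ∃ n, k ≤ n ∧ n ∈ C} = ⋃ n, ⋃ (_ : k ≤ n), {C | n ∈ C} := by ext; simp
    rw [this]
    exact .iUnion fun n => .iUnion fun _ => measurableSet_mem n
  have hk : ∀ k, ∀ᵐ ω ∂μ, (renewalSet fun p => ξ p ω) ∈ {C : Set ℕ | ∃ n, k ≤ n ∧ n ∈ C} := by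
    intro k
    induction k with
    | zero => exact Eventually.of_forall fun ω => ⟨0, le_rfl, zero_mem_renewalSet _⟩
    | succ k ih =>
      filter_upwards [ae_fromPoint_mem hF0 hm hind hlaw (hmeas k) ih,
        ae_exists_isFirst hF0 hm hind hlaw hdiv] with ω h1 ⟨n, hn⟩
      obtain ⟨l, hl, hlC⟩ := h1 n hn
      exact ⟨n + l, by have := hn.1; omega, hlC⟩
  filter_upwards [ae_all_iff.2 hk] with ω hω
  rw [Set.infinite_iff_exists_gt]
  intro a
  obtain ⟨n, hn, hnC⟩ := hω (a + 1)
  exact ⟨n, hnC, by omega⟩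

end Recurrence

section Gaps

/-- The gaps between the successive points of a set. -/
def gapSeq (C : Set ℕ) (k : ℕ) : ℕ := Nat.nth (· ∈ C) (k + 1) - Nat.nth (· ∈ C) k

lemma measurable_sInf_nat {α : Type*} [MeasurableSpace α] {g : α → Set ℕ}
    (hg : ∀ n, MeasurableSet {a | n ∈ g a}) : Measurable fun a => sInf (g a) := by
  refine measurable_of_Iic fun n => ?_
  have : (fun a => sInf (g a)) ⁻¹' Set.Iic n
      = (⋂ k, {a | k ∈ g a}ᶜ) ∪ ⋃ k, ⋃ (_ : k ≤ n), {a | k ∈ g a} := by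
    ext a
    simp only [Set.mem_preimage, Set.mem_Iic, Set.mem_union, Set.mem_iInter, Set.mem_compl_iff,
      Set.mem_iUnion, Set.mem_ofPred_eq, exists_prop]
    constructor
    · intro h
      by_cases hne : (g a).Nonempty
      · exact Or.inr ⟨_, h, Nat.sInf_mem hne⟩
      · exact Or.inl fun k hk => hne ⟨k, hk⟩
    · rintro (h | ⟨k, hk, hka⟩)
      · have : g a = ∅ := Set.eq_empty_of_forall_notMem h
        simp [this]
      · exact (Nat.sInf_le hka).trans hk
  rw [this]
  exact (MeasurableSet.iInter fun k => (hg k).compl).union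
    (.iUnion fun k => .iUnion fun _ => hg k)

lemma measurable_nth (k : ℕ) : Measurable fun C : Set ℕ => Nat.nth (· ∈ C) k := by
  induction k using Nat.strong_induction_on with
  | _ k ih =>
    simp_rw [fun C : Set ℕ => Nat.nth_eq_sInf (· ∈ C) k]
    refine measurable_sInf_nat fun n => ?_
    have : {C : Set ℕ | n ∈ {x | x ∈ C ∧ ∀ j < k, Nat.nth (· ∈ C) j < x}}
        = {C | n ∈ C} ∩ ⋂ j, ⋂ (_ : j < k), {C | Nat.nth (· ∈ C) j < n} := by
      ext; simp
    rw [this]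
    exact (measurableSet_mem n).inter (.iInter fun j => .iInter fun hj =>
      ih j hj measurableSet_Iio)

lemma measurable_gapSeq : Measurable gapSeq :=
  measurable_pi_iff.2 fun k => (measurable_nth (k + 1)).sub (measurable_nth k)

lemma eq_nth_of_strictMono {C : Set ℕ} {g : ℕ → ℕ} (hg : StrictMono g) (hrange : Set.range g = C)
    (k : ℕ) : Nat.nth (· ∈ C) k = g k := by
  subst hrange
  have hinf : (Set.ofPred (· ∈ Set.range g)).Infinite :=
    Set.infinite_range_of_injective hg.injective
  refine ((Nat.eq_nth_of_strictMonoOn_of_mapsTo_of_surjOn (p := (· ∈ Set.range g)) g ?_ ?_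
    (hg.strictMonoOn _)) fun hf => absurd hf hinf).symm
  · rintro _ ⟨k, rfl⟩
    exact ⟨k, fun hf => absurd hf hinf, rfl⟩
  · exact fun k _ => ⟨k, rfl⟩

lemma range_nth_mem {C : Set ℕ} (hC : C.Infinite) : Set.range (Nat.nth (· ∈ C)) = C :=
  Nat.range_nth_of_infinite hC

lemma nth_mem_zero {C : Set ℕ} (h0 : 0 ∈ C) : Nat.nth (· ∈ C) 0 = 0 :=
  Nat.nth_zero_of_zero h0

lemma infinite_fromPoint {C : Set ℕ} (hC : C.Infinite) (n : ℕ) : (fromPoint n C).Infinite := by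
  rw [Set.infinite_iff_exists_gt] at hC ⊢
  intro a
  obtain ⟨b, hb, hlt⟩ := hC (n + a)
  exact ⟨b - n, by change n + (b - n) ∈ C; rwa [Nat.add_sub_cancel' (by omega)], by omega⟩

lemma nth_succ_eq_add_nth_fromPoint {C : Set ℕ} (hC : C.Infinite) (h0 : 0 ∈ C) {n : ℕ}
    (hn : IsFirst n C) (k : ℕ) :
    Nat.nth (· ∈ C) (k + 1) = n + Nat.nth (· ∈ fromPoint n C) k := by
  have hD := infinite_fromPoint hC n
  let g : ℕ → ℕ := fun k => Nat.casesOn k 0 fun j => n + Nat.nth (· ∈ fromPoint n C) j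
  have hg : StrictMono g := by
    refine strictMono_nat_of_lt_succ fun k => ?_
    cases k with
    | zero => exact Nat.add_pos_left hn.1 _
    | succ j => exact Nat.add_lt_add_left (Nat.nth_strictMono hD (Nat.lt_succ_self j)) n
  have hr : Set.range g = C := by
    ext l
    constructor
    · rintro ⟨k, rfl⟩
      cases k with
      | zero => exact h0
      | succ j => exact Nat.nth_mem_of_infinite hD j
    · intro hl
      rcases Nat.eq_zero_or_pos l with rfl | hpos
      · exact ⟨0, rfl⟩
      · have hle : n ≤ l := by
          by_contra! hlt
          exact hn.2.2 l hpos hlt hl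
        have hmem : l - n ∈ fromPoint n C := by
          change n + (l - n) ∈ C; rwa [Nat.add_sub_cancel' hle]
        rw [← range_nth_mem hD] at hmem
        obtain ⟨j, hj⟩ := hmem
        refine ⟨j + 1, ?_⟩
        change n + Nat.nth (· ∈ fromPoint n C) j = l
        omega
  exact eq_nth_of_strictMono hg hr (k + 1)

lemma IsFirst.gapSeq_succ {C : Set ℕ} {n : ℕ} (hn : IsFirst n C) (hC : C.Infinite) (h0 : 0 ∈ C)
    (k : ℕ) : gapSeq C (k + 1) = gapSeq (fromPoint n C) k := by
  simp only [gapSeq, nth_succ_eq_add_nth_fromPoint hC h0 hn]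
  omega

lemma IsFirst.gapSeq_zero {C : Set ℕ} {n : ℕ} (hn : IsFirst n C) (hC : C.Infinite) (h0 : 0 ∈ C) :
    gapSeq C 0 = n := by
  have h0' : 0 ∈ fromPoint n C := hn.2.1
  simp only [gapSeq, nth_succ_eq_add_nth_fromPoint hC h0 hn, nth_mem_zero h0, nth_mem_zero h0']
  rfl

lemma isFirst_iff_gapSeq_zero {C : Set ℕ} (hC : C.Infinite) (h0 : 0 ∈ C) (n : ℕ) :
    IsFirst n C ↔ gapSeq C 0 = n := by
  refine ⟨fun h => h.gapSeq_zero hC h0, ?_⟩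
  rintro rfl
  obtain ⟨b, hb, hlt⟩ := (Set.infinite_iff_exists_gt.1 hC) 0
  obtain ⟨l, -, hl⟩ := exists_isFirst hlt hb
  rwa [hl.gapSeq_zero hC h0]

variable {Ω : Type*} [MeasurableSpace Ω] {μ : Measure Ω} {ι : Type*} [Fintype ι] {F : Measure ℕ}
  {ξ : ι × ℕ → Ω → ℕ}

lemma measure_gapSeq_mem_eq_prod (hF0 : F {0} = 0)
    (hm : ∀ p, Measurable (ξ p)) (hind : iIndepFun ξ μ) (hlaw : ∀ p, μ.map (ξ p) = F)
    (hinf : ∀ᵐ ω ∂μ, (renewalSet fun p => ξ p ω).Infinite) (K : ℕ) (A : ℕ → Set ℕ) :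
    μ {ω | ∀ j < K, gapSeq (renewalSet fun p => ξ p ω) j ∈ A j}
      = ∏ j ∈ Finset.range K, μ {ω | gapSeq (renewalSet fun p => ξ p ω) 0 ∈ A j} := by
  have := hind.isProbabilityMeasure
  induction K generalizing A with
  | zero => simp
  | succ K ih =>
    let C : Ω → Set ℕ := fun ω => renewalSet fun p => ξ p ω
    let B : Set (Set ℕ) := {D | ∀ j < K, gapSeq D j ∈ A (j + 1)}
    have hB : MeasurableSet B := by
      have : B = ⋂ j, ⋂ (_ : j < K), {D | gapSeq D j ∈ A (j + 1)} := by ext; simp [B]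
      rw [this]
      exact .iInter fun j => .iInter fun _ =>
        (measurable_pi_iff.1 measurable_gapSeq j) (Set.to_countable _).measurableSet
    have hfirst : μ {ω | gapSeq (C ω) 0 ∈ A 0} = ∑' n : A 0, μ {ω | IsFirst n (C ω)} := by
      rw [← measure_iUnion]
      · refine measure_congr ?_
        filter_upwards [hinf] with ω hω
        refine propext ?_
        change gapSeq (C ω) 0 ∈ A 0 ↔ ω ∈ ⋃ n : A 0, {ω | IsFirst n (C ω)}
        simp only [Set.mem_iUnion, Set.mem_ofPred_eq,
          isFirst_iff_gapSeq_zero hω (zero_mem_renewalSet _), C]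
        simp
      · exact fun k l hkl => Set.disjoint_left.2 fun ω h1 h2 =>
          hkl (Subtype.ext (IsFirst.eq h1 h2))
      · exact fun n => measurableSet_isFirst_renewalSet hm n
    have hsplit : μ {ω | ∀ j < K + 1, gapSeq (C ω) j ∈ A j}
        = ∑' n : A 0, μ {ω | IsFirst n (C ω) ∧ fromPoint n (C ω) ∈ B} := by
      rw [← measure_iUnion]
      · refine measure_congr ?_
        filter_upwards [hinf] with ω hω
        refine propext ?_
        change (∀ j < K + 1, gapSeq (C ω) j ∈ A j) ↔
          ω ∈ ⋃ n : A 0, {ω | IsFirst n (C ω) ∧ fromPoint n (C ω) ∈ B}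
        have h0 : 0 ∈ C ω := zero_mem_renewalSet _
        rw [Set.mem_iUnion]
        constructor
        · intro h
          have hf := (isFirst_iff_gapSeq_zero hω h0 _).2 rfl
          refine ⟨⟨gapSeq (C ω) 0, h 0 (Nat.succ_pos K)⟩, hf, fun j hj => ?_⟩
          rw [← hf.gapSeq_succ hω h0]
          exact h (j + 1) (by omega)
        · rintro ⟨⟨n, hn⟩, hf, hBn⟩ j hj
          cases j with
          | zero => rw [IsFirst.gapSeq_zero hf hω h0]; exact hn
          | succ j =>
            rw [IsFirst.gapSeq_succ hf hω h0]
            exact hBn j (by omega)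
      · exact fun k l hkl => Set.disjoint_left.2 fun ω h1 h2 =>
          hkl (Subtype.ext (IsFirst.eq h1.1 h2.1))
      · exact fun n => (measurableSet_isFirst_renewalSet hm n).inter
          ((measurable_fromPoint n).comp (measurable_renewalSet_comp hm) hB)
    have hcalc : ∑' n : A 0, μ {ω | IsFirst n (C ω) ∧ fromPoint n (C ω) ∈ B}
        = μ {ω | gapSeq (C ω) 0 ∈ A 0} * μ {ω | C ω ∈ B} := by
      rw [hfirst, ← ENNReal.tsum_mul_right]
      exact tsum_congr fun n => measure_isFirst_inter_fromPoint hF0 hm hind hlaw n hB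
    rw [Finset.prod_range_succ', mul_comm, ← ih fun j => A (j + 1)]
    exact hsplit.trans hcalc

/-- The gaps between successive simultaneous renewal times are independent and identically
distributed. -/
lemma map_gapSeq_eq_infinitePi (hF0 : F {0} = 0)
    (hm : ∀ p, Measurable (ξ p)) (hind : iIndepFun ξ μ) (hlaw : ∀ p, μ.map (ξ p) = F)
    (hinf : ∀ᵐ ω ∂μ, (renewalSet fun p => ξ p ω).Infinite) :
    μ.map (fun ω => gapSeq (renewalSet fun p => ξ p ω)) = Measure.infinitePi fun _ : ℕ =>
      μ.map fun ω => gapSeq (renewalSet fun p => ξ p ω) 0 := by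
  classical
  have := hind.isProbabilityMeasure
  have hgm : Measurable fun ω => gapSeq (renewalSet fun p => ξ p ω) :=
    measurable_gapSeq.comp (measurable_renewalSet_comp hm)
  have hgm0 : Measurable fun ω => gapSeq (renewalSet fun p => ξ p ω) 0 :=
    measurable_pi_iff.1 hgm 0
  have : IsProbabilityMeasure (μ.map fun ω => gapSeq (renewalSet fun p => ξ p ω) 0) :=
    Measure.isProbabilityMeasure_map hgm0.aemeasurable
  refine Measure.eq_infinitePi _ fun s A hA => ?_
  obtain ⟨K, hK⟩ : ∃ K, s ⊆ Finset.range K :=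
    ⟨s.sup id + 1, fun j hj => Finset.mem_range.2 (Nat.lt_succ_of_le (Finset.le_sup (f := id) hj))⟩
  have h := measure_gapSeq_mem_eq_prod hF0 hm hind hlaw hinf K
    fun j => if j ∈ s then A j else Set.univ
  rw [Measure.map_apply hgm (MeasurableSet.pi s.countable_toSet fun j _ => hA j)]
  convert h using 1
  · congr 1
    ext ω
    simp only [Set.mem_preimage, Set.mem_pi, Finset.mem_coe, Set.mem_ofPred_eq]
    constructor
    · intro hω j _
      by_cases hj : j ∈ s
      · simpa [hj] using hω j hj
      · simp [hj]
    · intro hω j hj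
      simpa [hj] using hω j (Finset.mem_range.1 (hK hj))
  · rw [← Finset.prod_subset hK]
    · refine Finset.prod_congr rfl fun j hj => ?_
      rw [Measure.map_apply hgm0 (hA j)]
      simp only [hj, if_true]
      rfl
    · intro j _ hj
      simp [hj]

end Gaps

section AvoidProb

variable (ρ : Measure (ℕ → ℕ))

/-- The trajectories which at positive times avoid the points `η 0 + ⋯ + η (i - 1)`, `i ∈ I`. -/
def avoidSet (I : Set ℕ) (η : ℕ → ℕ) : Set (ℕ → ℕ) :=
  {y | ∀ i ∈ I, ∀ t, 1 ≤ t → y t ≠ ∑ j ∈ Finset.range i, η j}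

/-- The probability that a process of law `ρ` at positive times avoids the points
`η 0 + ⋯ + η (i - 1)`, `i ∈ I`. -/
def avoidProb (I : Set ℕ) (η : ℕ → ℕ) : ℝ := ρ.real (avoidSet I η)

/-- The capacity of the first `n` points of the set with gaps `η`, with respect to an increasing
process of law `ρ`. -/
def gapCapacity (n : ℕ) (η : ℕ → ℕ) : ℝ :=
  ∑ k ∈ Finset.range n, avoidProb ρ (Set.Icc 1 (n - 1 - k)) (seqShift^[k] η)

lemma avoidSet_anti {I J : Set ℕ} (h : I ⊆ J) (η : ℕ → ℕ) : avoidSet J η ⊆ avoidSet I η :=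
  fun _ hy i hi => hy i (h hi)

lemma measurableSet_uncurry_avoidSet (I : Set ℕ) :
    MeasurableSet {q : (ℕ → ℕ) × (ℕ → ℕ) | q.2 ∈ avoidSet I q.1} := by
  have : {q : (ℕ → ℕ) × (ℕ → ℕ) | q.2 ∈ avoidSet I q.1}
      = ⋂ i, ⋂ (_ : i ∈ I), ⋂ t, ⋂ (_ : 1 ≤ t), {q | q.2 t = ∑ j ∈ Finset.range i, q.1 j}ᶜ := by
    ext; simp [avoidSet]
  rw [this]
  refine .iInter fun i => .iInter fun _ => .iInter fun t => .iInter fun _ => ?_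
  refine (measurableSet_eq_fun ((measurable_pi_apply t).comp measurable_snd) ?_).compl
  exact Finset.measurable_fun_sum _ fun j _ => (measurable_pi_apply j).comp measurable_fst

lemma measurableSet_avoidSet (I : Set ℕ) (η : ℕ → ℕ) : MeasurableSet (avoidSet I η) :=
  (measurable_prodMk_left (x := η)) (measurableSet_uncurry_avoidSet I)

lemma avoidProb_nonneg (I : Set ℕ) (η : ℕ → ℕ) : 0 ≤ avoidProb ρ I η := measureReal_nonneg

lemma gapCapacity_nonneg (n : ℕ) (η : ℕ → ℕ) : 0 ≤ gapCapacity ρ n η :=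
  Finset.sum_nonneg fun _ _ => avoidProb_nonneg ρ _ _

variable [IsProbabilityMeasure ρ]

lemma avoidProb_le_one (I : Set ℕ) (η : ℕ → ℕ) : avoidProb ρ I η ≤ 1 := measureReal_le_one

lemma abs_avoidProb_le_one (I : Set ℕ) (η : ℕ → ℕ) : |avoidProb ρ I η| ≤ 1 := by
  rw [abs_of_nonneg (avoidProb_nonneg ρ I η)]; exact avoidProb_le_one ρ I η

lemma avoidProb_anti {I J : Set ℕ} (h : I ⊆ J) (η : ℕ → ℕ) : avoidProb ρ J η ≤ avoidProb ρ I η :=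
  measureReal_mono (avoidSet_anti h η)

lemma measurable_avoidProb (I : Set ℕ) : Measurable (avoidProb ρ I) :=
  (measurable_measure_prodMk_left (measurableSet_uncurry_avoidSet I)).ennreal_toReal

lemma tendsto_avoidProb_Icc (η : ℕ → ℕ) :
    Tendsto (fun J : ℕ => avoidProb ρ (Set.Icc 1 J) η) atTop (𝓝 (avoidProb ρ (Set.Ici 1) η)) := by
  have hI : avoidSet (Set.Ici 1) η = ⋂ J : ℕ, avoidSet (Set.Icc 1 J) η := by
    refine Set.Subset.antisymm (Set.subset_iInter fun J => avoidSet_anti Set.Icc_subset_Ici_self η)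
      fun y hy i hi => Set.mem_iInter.1 hy i i ⟨hi, le_rfl⟩
  unfold avoidProb Measure.real
  rw [hI]
  refine (ENNReal.tendsto_toReal (measure_ne_top _ _)).comp
    (tendsto_measure_iInter_atTop (fun J => (measurableSet_avoidSet _ η).nullMeasurableSet) ?_
      ⟨0, measure_ne_top _ _⟩)
  exact fun J K h => avoidSet_anti (Set.Icc_subset_Icc_right h) η

lemma tendsto_integral_avoidProb_Icc (ν : Measure (ℕ → ℕ)) [IsProbabilityMeasure ν] :
    Tendsto (fun J : ℕ => ∫ η, avoidProb ρ (Set.Icc 1 J) η ∂ν) atTop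
      (𝓝 (∫ η, avoidProb ρ (Set.Ici 1) η ∂ν)) :=
  tendsto_integral_of_dominated_convergence (fun _ => 1)
    (fun _ => (measurable_avoidProb ρ _).aestronglyMeasurable) (integrable_const 1)
    (fun _ => Eventually.of_forall fun η => abs_avoidProb_le_one ρ _ η)
    (Eventually.of_forall fun η => tendsto_avoidProb_Icc ρ η)

lemma measurable_gapCapacity (n : ℕ) : Measurable (gapCapacity ρ n) :=
  Finset.measurable_fun_sum _ fun k _ => (measurable_avoidProb ρ _).comp
    (measurable_seqShift.iterate k)

lemma gapCapacity_le (n : ℕ) (η : ℕ → ℕ) : gapCapacity ρ n η ≤ n := by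
  refine (Finset.sum_le_sum fun k _ => avoidProb_le_one ρ _ _).trans ?_
  simp

lemma birkhoffSum_le_gapCapacity (n : ℕ) (η : ℕ → ℕ) :
    birkhoffSum seqShift (avoidProb ρ (Set.Ici 1)) n η ≤ gapCapacity ρ n η :=
  Finset.sum_le_sum fun _ _ => avoidProb_anti ρ Set.Icc_subset_Ici_self _

lemma gapCapacity_le_birkhoffSum_add (J n : ℕ) (η : ℕ → ℕ) :
    gapCapacity ρ n η ≤ birkhoffSum seqShift (avoidProb ρ (Set.Icc 1 J)) n η + J := by
  have hterm : ∀ k ∈ Finset.range n, avoidProb ρ (Set.Icc 1 (n - 1 - k)) (seqShift^[k] η)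
      ≤ avoidProb ρ (Set.Icc 1 J) (seqShift^[k] η) + if n - J ≤ k then 1 else 0 := by
    intro k hk
    split_ifs with h
    · linarith [avoidProb_le_one ρ (Set.Icc 1 (n - 1 - k)) (seqShift^[k] η),
        avoidProb_nonneg ρ (Set.Icc 1 J) (seqShift^[k] η)]
    · rw [add_zero]
      exact avoidProb_anti ρ (Set.Icc_subset_Icc_right (by omega)) _
  refine (Finset.sum_le_sum hterm).trans ?_
  rw [Finset.sum_add_distrib]
  refine add_le_add le_rfl ?_
  rw [Finset.sum_boole]
  have hcard : (Finset.filter (fun k => n - J ≤ k) (Finset.range n)).card ≤ J := by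
    refine (Finset.card_le_card (t := Finset.Ico (n - J) n) fun k hk => ?_).trans
      (by rw [Nat.card_Ico]; omega)
    simp only [Finset.mem_filter, Finset.mem_range] at hk
    exact Finset.mem_Ico.2 ⟨hk.2, hk.1⟩
  exact_mod_cast hcard

/-- Law of large numbers for the capacity of a set with independent, identically distributed
gaps. -/
lemma ae_tendsto_gapCapacity_div (G : Measure ℕ) [IsProbabilityMeasure G] :
    ∀ᵐ η ∂(Measure.infinitePi fun _ : ℕ => G),
      Tendsto (fun n : ℕ => gapCapacity ρ n η / n) atTop
        (𝓝 (∫ η, avoidProb ρ (Set.Ici 1) η ∂(Measure.infinitePi fun _ : ℕ => G))) := by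
  have herg := ergodic_seqShift G
  have hbirk : ∀ I : Set ℕ, _ := fun I =>
    ae_tendsto_birkhoffAverage herg (measurable_avoidProb ρ I) (abs_avoidProb_le_one ρ I)
  filter_upwards [hbirk (Set.Ici 1), ae_all_iff.2 fun J : ℕ => hbirk (Set.Icc 1 J)] with η h1 h2
  have havg : ∀ (f : (ℕ → ℕ) → ℝ) (n : ℕ),
      birkhoffAverage ℝ seqShift f n η = birkhoffSum seqShift f n η / n := fun f n => by
    rw [birkhoffAverage, smul_eq_mul, inv_mul_eq_div]
  refine tendsto_order.2 ⟨fun a ha => ?_, fun a ha => ?_⟩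
  · filter_upwards [h1.eventually (lt_mem_nhds ha)] with n hn
    refine hn.trans_le ?_
    rw [havg]
    gcongr
    exact birkhoffSum_le_gapCapacity ρ n η
  · obtain ⟨J, hJ⟩ := ((tendsto_integral_avoidProb_Icc ρ
      (Measure.infinitePi fun _ : ℕ => G)).eventually (gt_mem_nhds ha)).exists
    have hlim := (h2 J).add (tendsto_const_div_atTop_nhds_zero_nat (J : ℝ))
    rw [add_zero] at hlim
    filter_upwards [hlim.eventually (gt_mem_nhds hJ)] with n hn
    refine lt_of_le_of_lt ?_ hn
    rw [havg, ← add_div]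
    gcongr
    exact gapCapacity_le_birkhoffSum_add ρ J n η

end AvoidProb

section CapacityOfSet

lemma nth_add_eq {C : Set ℕ} (hC : C.Infinite) (k i : ℕ) :
    Nat.nth (· ∈ C) (k + i)
      = Nat.nth (· ∈ C) k + ∑ j ∈ Finset.range i, (seqShift^[k] (gapSeq C)) j := by
  induction i with
  | zero => simp
  | succ i ih =>
    rw [Finset.sum_range_succ, ← add_assoc (Nat.nth _ k), ← ih, seqShift_iterate, gapSeq,
      add_comm i k]
    have := Nat.nth_monotone (p := (· ∈ C)) hC (Nat.le_succ (k + i))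
    change _ ≤ Nat.nth (· ∈ C) (k + i + 1) at this
    rw [← add_assoc]
    omega

lemma sum_gapSeq {C : Set ℕ} (hC : C.Infinite) (h0 : 0 ∈ C) (i : ℕ) :
    ∑ j ∈ Finset.range i, gapSeq C j = Nat.nth (· ∈ C) i := by
  have := nth_add_eq hC 0 i
  rw [nth_mem_zero h0] at this
  simpa using this.symm

variable {Ω : Type*} [MeasurableSpace Ω] {μ : Measure Ω}

lemma capacity_image_nth {X : ℕ → Ω → ℕ} (hX : ∀ t, Measurable (X t))
    (hpos : ∀ᵐ ω ∂μ, ∀ t, 1 ≤ t → 0 < X t ω) {C : Set ℕ} (hC : C.Infinite) (n : ℕ) :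
    capacity μ (fun t ω => (X t ω : ℤ))
        ((Finset.Ico 0 n).image fun k => (Nat.nth (· ∈ C) k : ℤ))
      = gapCapacity (μ.map fun ω t => X t ω) n (gapSeq C) := by
  have hmono : StrictMono (Nat.nth (· ∈ C)) := Nat.nth_strictMono hC
  have hXm : Measurable fun ω t => X t ω := measurable_pi_iff.2 hX
  rw [capacity, gapCapacity, Finset.sum_image fun k _ l _ h => hmono.injective (by exact_mod_cast h),
    ← Finset.range_eq_Ico]
  refine Finset.sum_congr rfl fun k hk => ?_
  have hkn := Finset.mem_range.1 hk
  rw [avoidProb, map_measureReal_apply hXm (measurableSet_avoidSet _ _)]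
  refine measureReal_congr ?_
  filter_upwards [hpos] with ω hω
  refine propext ?_
  change (∀ t, 1 ≤ t → _) ↔ ∀ i ∈ Set.Icc 1 (n - 1 - k), ∀ t, 1 ≤ t → _
  constructor
  · intro h i hi t ht heq
    refine h t ht (Finset.mem_image.2 ⟨k + i, Finset.mem_range.2 ?_, ?_⟩)
    · have := hi.1; have := hi.2; omega
    · rw [nth_add_eq hC k i, ← heq]; push_cast; rfl
  · intro h t ht hmem
    obtain ⟨l, hl, hlt⟩ := Finset.mem_image.1 hmem
    have hln := Finset.mem_range.1 hl
    have heq : Nat.nth (· ∈ C) l = Nat.nth (· ∈ C) k + X t ω := by exact_mod_cast hlt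
    have hkl : k < l := hmono.lt_iff_lt.1 (by have := hω t ht; omega)
    obtain ⟨i, rfl⟩ := Nat.exists_eq_add_of_le hkl.le
    rw [nth_add_eq hC k i] at heq
    exact h i ⟨by omega, by omega⟩ t ht (Nat.add_left_cancel heq).symm

end CapacityOfSet

section Escape

variable {Ω : Type*} [MeasurableSpace Ω] {μ : Measure Ω} [IsProbabilityMeasure μ]

lemma integral_avoidProb_eq {η Y : Ω → ℕ → ℕ} (hη : Measurable η) (hY : Measurable Y)
    (hind : IndepFun η Y μ) (I : Set ℕ) :
    ∫ e, avoidProb (μ.map Y) I e ∂(μ.map η) = μ.real {ω | Y ω ∈ avoidSet I (η ω)} := by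
  have := Measure.isProbabilityMeasure_map (μ := μ) hY.aemeasurable
  have := Measure.isProbabilityMeasure_map (μ := μ) hη.aemeasurable
  have hW := measurableSet_uncurry_avoidSet I
  have h1 : μ {ω | Y ω ∈ avoidSet I (η ω)}
      = ((μ.map η).prod (μ.map Y)) {q | q.2 ∈ avoidSet I q.1} := by
    rw [← (indepFun_iff_map_prod_eq_prod_map_map hη.aemeasurable hY.aemeasurable).1 hind,
      Measure.map_apply (hη.prodMk hY) hW]
    rfl
  rw [Measure.real, h1, Measure.prod_apply hW]
  exact integral_toReal (measurable_measure_prodMk_left hW).aemeasurable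
    (Eventually.of_forall fun e => measure_lt_top _ _)

end Escape

end

end RenewalCapacity

open RenewalCapacity in
theorem mainTheorem7 {Ω : Type*} [MeasurableSpace Ω] (μ : Measure Ω) [IsProbabilityMeasure μ]
    (m : ℕ) (hm : 2 ≤ m) (β : ℝ) (hβ : β ∈ Set.Ioo (((m : ℝ) - 1) / m) ((m : ℝ) / (m + 1)))
    (F : Measure ℕ) [IsProbabilityMeasure F] (hF : IsEpochLaw β F)
    (S : Fin (m + 1) → ℕ → Ω → ℕ) (hS : ∀ i, IsRenewalProcess F μ (S i))
    (hindep : iIndepFun (fun i ω t => S i t ω) μ) :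
    (∀ᵐ ω ∂μ, (commonRange (fun i : Fin m => S i.castSucc) ω).Infinite) ∧
    (∀ᵐ ω ∂μ, Tendsto (fun n : ℕ => rangeCapacity μ S 0 n ω / n) atTop (𝓝 (escapeProb μ S))) ∧
    (∀ n : ℕ, Integrable (rangeCapacity μ S 0 n) μ) ∧
    Tendsto (fun n : ℕ => ∫ ω, |rangeCapacity μ S 0 n ω / n - escapeProb μ S| ∂μ)
      atTop (𝓝 0) := by
  choose ξ hξm hξlaw hξind hξS using hS
  have hF0 := hF.zero
  have hSm : ∀ i t, Measurable (S i t) := fun i t => by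
    have : S i t = fun ω => ∑ k ∈ Finset.range t, ξ i k ω := funext (hξS i t)
    rw [this]; exact measurable_sum_range (hξm i) t
  have hrows : iIndepFun (fun i ω k => ξ i k ω) μ := by
    have h := hindep.comp (fun _ s k => s (k + 1) - s k) fun _ =>
      measurable_pi_iff.2 fun k => (measurable_pi_apply (k + 1)).sub (measurable_pi_apply k)
    convert h using 1
    funext i ω k
    simp [hξS, Finset.sum_range_succ]
  have hall : iIndepFun (fun (p : Fin (m + 1) × ℕ) ω => ξ p.1 p.2 ω) μ :=
    iIndepFun_uncurry' hξm hrows hξind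
  let x : Fin m × ℕ → Ω → ℕ := fun p => ξ p.1.castSucc p.2
  have hxm : ∀ p, Measurable (x p) := fun p => hξm _ _
  have hxlaw : ∀ p, μ.map (x p) = F := fun p => hξlaw _ _
  have hemb : Function.Injective fun p : Fin m × ℕ => (p.1.castSucc, p.2) := fun p q h => by
    simp only [Prod.mk.injEq, Fin.castSucc_inj] at h
    exact Prod.ext h.1 h.2
  have hxind : iIndepFun x μ := hall.precomp hemb
  let C : Ω → Set ℕ := fun ω => renewalSet fun p => x p ω
  have hcommon : ∀ ω, commonRange (fun i : Fin m => S i.castSucc) ω = C ω := fun ω => by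
    ext n
    simp [commonRange, rangeOf, C, renewalSet, x, hξS]
  have h0 : ∀ ω, 0 ∈ C ω := fun ω => zero_mem_renewalSet _
  -- the expected number of simultaneous renewal times is infinite
  let u : ℕ → ℝ := fun n =>
    (Measure.infinitePi fun _ : ℕ => F).real {y | ∃ t, ∑ k ∈ Finset.range t, y k = n}
  have hset : ∀ n, MeasurableSet {y : ℕ → ℕ | ∃ t, ∑ k ∈ Finset.range t, y k = n} := fun n => by
    refine measurableSet_setOfPred.2 (Measurable.exists fun t => ?_)
    exact (measurable_sum_range (ξ := fun k (y : ℕ → ℕ) => y k)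
      (fun k => measurable_pi_apply k) t).eq_const n
  have hrenew : ∀ n, 1 ≤ ∑ k ∈ Finset.range (n + 1), u k * tail F (n - k) :=
    one_le_sum_renewalMass_mul_tail (μ := Measure.infinitePi fun _ : ℕ => F)
      (ξ := fun k (y : ℕ → ℕ) => y k) hF0 (fun k => measurable_pi_apply k)
      (iIndepFun_infinitePi (P := fun _ : ℕ => F) (X := fun _ z => z) fun _ => measurable_id)
      fun k => Measure.infinitePi_map_eval (fun _ : ℕ => F) k
  have hmass : ∀ n, μ.real {ω | n ∈ C ω} = u n ^ m := fun n => by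
    have hrows' := hrows.precomp (Fin.castSucc_injective m)
    have h := hrows'.measure_inter_preimage_eq_mul Finset.univ
      (sets := fun _ => {y : ℕ → ℕ | ∃ t, ∑ k ∈ Finset.range t, y k = n}) fun _ _ => hset n
    have he : {ω | n ∈ C ω} = ⋂ i ∈ (Finset.univ : Finset (Fin m)),
        (fun ω k => ξ i.castSucc k ω) ⁻¹' {y : ℕ → ℕ | ∃ t, ∑ k ∈ Finset.range t, y k = n} := by
      ext ω; simp [C, renewalSet, x]
    have hi : ∀ i : Fin m, μ ((fun ω k => ξ i.castSucc k ω) ⁻¹'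
        {y : ℕ → ℕ | ∃ t, ∑ k ∈ Finset.range t, y k = n})
        = (Measure.infinitePi fun _ : ℕ => F) {y | ∃ t, ∑ k ∈ Finset.range t, y k = n} := by
      intro i
      rw [← map_comp_eq_infinitePi (hξm i.castSucc) (hξind i.castSucc) (hξlaw i.castSucc)
        Function.injective_id, Measure.map_apply (measurable_pi_iff.2 fun k => hξm _ _) (hset n)]
      rfl
    rw [Measure.real, he, h]
    simp only [hi, Finset.prod_const, Finset.card_univ, Fintype.card_fin, ENNReal.toReal_pow]
    rfl
  have hdiv : ∀ B : ℝ, ∃ N, B < ∑ n ∈ Finset.range N, μ.real {ω | n ∈ C ω} := fun B => by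
    simp only [hmass]
    exact exists_lt_sum_pow (by omega) hβ.1 hF (fun _ => measureReal_nonneg) hrenew B
  have hinf : ∀ᵐ ω ∂μ, (C ω).Infinite := ae_infinite_renewalSet hF0 hxm hxind hxlaw hdiv
  -- the gaps and the last process
  let η : Ω → ℕ → ℕ := fun ω => gapSeq (C ω)
  let Y : Ω → ℕ → ℕ := fun ω t => S (Fin.last m) t ω
  have hηm : Measurable η := measurable_gapSeq.comp (measurable_renewalSet_comp hxm)
  have hYm : Measurable Y := measurable_pi_iff.2 fun t => hSm _ t
  have hYprob := Measure.isProbabilityMeasure_map (μ := μ) hYm.aemeasurable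
  have hηlaw := map_gapSeq_eq_infinitePi hF0 hxm hxind hxlaw hinf
  have hG : IsProbabilityMeasure (μ.map fun ω => η ω 0) :=
    Measure.isProbabilityMeasure_map (measurable_pi_iff.1 hηm 0).aemeasurable
  have hηY : IndepFun η Y μ := by
    have h := indepFun_comp_of_disjoint (fun p => hξm p.1 p.2) hall
      {p : Fin (m + 1) × ℕ | p.1 ≠ Fin.last m}
      (f := fun p : Fin m × ℕ => (p.1.castSucc, p.2)) (g := fun k : ℕ => (Fin.last m, k))
      (fun p => Fin.castSucc_ne_last p.1) fun k => by simp
    have h' := h.comp (φ := fun z => gapSeq (renewalSet z))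
      (ψ := fun (y : ℕ → ℕ) (t : ℕ) => ∑ k ∈ Finset.range t, y k)
      (measurable_gapSeq.comp measurable_renewalSet)
      (measurable_pi_iff.2 fun t => measurable_sum_range (ξ := fun k (y : ℕ → ℕ) => y k)
        (fun k => measurable_pi_apply k) t)
    have hYeq : Y = fun ω t => ∑ k ∈ Finset.range t, ξ (Fin.last m) k ω := by
      funext ω t; exact hξS _ t ω
    rw [hYeq]
    exact h'
  have hYpos : ∀ᵐ ω ∂μ, ∀ t, 1 ≤ t → 0 < S (Fin.last m) t ω := by
    filter_upwards [ae_pos_of_law hF0 (hξm (Fin.last m)) (hξlaw (Fin.last m))] with ω hω t ht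
    rw [hξS]
    exact (strictMono_sum_range hω) (show 0 < t from ht)
  have hcap : ∀ᵐ ω ∂μ, ∀ n, rangeCapacity μ S 0 n ω = gapCapacity (μ.map Y) n (η ω) := by
    filter_upwards [hinf] with ω hω n
    have h := capacity_image_nth (fun t => hSm (Fin.last m) t) hYpos hω n
    rw [← h, rangeCapacity, truncatedRange]
    simp only [simultaneous, hcommon]
  have hesc : ∫ e, avoidProb (μ.map Y) (Set.Ici 1) e ∂(μ.map η) = escapeProb μ S := by
    rw [integral_avoidProb_eq hηm hYm hηY, escapeProb]
    refine measureReal_congr ?_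
    filter_upwards [hinf, hYpos] with ω hω hpos
    refine propext ?_
    change (∀ i ∈ Set.Ici 1, ∀ t, 1 ≤ t → Y ω t ≠ ∑ j ∈ Finset.range i, gapSeq (C ω) j) ↔
      commonRange S ω = {0}
    have hmem : ∀ n, n ∈ commonRange S ω ↔ n ∈ C ω ∧ ∃ t, Y ω t = n := fun n => by
      rw [← hcommon]
      simp only [commonRange, rangeOf, Set.mem_iInter, Set.mem_range, Y]
      exact Fin.forall_fin_succ'
    have hY0 : Y ω 0 = 0 := by simp [Y, hξS]
    simp only [sum_gapSeq hω (h0 ω)]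
    constructor
    · intro h
      ext n
      rw [hmem, Set.mem_singleton_iff]
      constructor
      · rintro ⟨hn, t, rfl⟩
        by_contra hne
        have ht : 1 ≤ t := Nat.one_le_iff_ne_zero.2 fun h => hne (by rw [h, hY0])
        rw [← range_nth_mem hω] at hn
        obtain ⟨i, hi⟩ := hn
        refine h i (Nat.one_le_iff_ne_zero.2 fun h => hne ?_) t ht hi.symm
        rw [← hi, h, nth_mem_zero (h0 ω)]
      · rintro rfl
        exact ⟨h0 ω, 0, hY0⟩
    · intro h i _ t ht heq
      have hin : Y ω t ∈ commonRange S ω :=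
        (hmem _).2 ⟨heq ▸ Nat.nth_mem_of_infinite hω i, t, rfl⟩
      rw [h, Set.mem_singleton_iff] at hin
      exact (hpos t ht).ne' hin
  have hlim : ∀ᵐ ω ∂μ,
      Tendsto (fun n : ℕ => rangeCapacity μ S 0 n ω / n) atTop (𝓝 (escapeProb μ S)) := by
    have h := ae_tendsto_gapCapacity_div (μ.map Y) (μ.map fun ω => η ω 0)
    rw [← hηlaw] at h
    have h' := ae_of_ae_map hηm.aemeasurable h
    filter_upwards [h', hcap] with ω hω hc
    simp only [hc]
    rw [← hesc]
    exact hω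
  have haesm : ∀ n, AEStronglyMeasurable (rangeCapacity μ S 0 n) μ := fun n =>
    ((measurable_gapCapacity (μ.map Y) n).comp hηm).aestronglyMeasurable.congr
      (hcap.mono fun ω hω => (hω n).symm)
  refine ⟨hinf.mono fun ω hω => by rwa [hcommon], hlim, fun n => ?_, ?_⟩
  · refine .of_bound (haesm n) n (hcap.mono fun ω hω => ?_)
    rw [hω n, Real.norm_of_nonneg (gapCapacity_nonneg _ _ _)]
    exact gapCapacity_le _ _ _
  · have h := tendsto_integral_of_dominated_convergence (μ := μ)
      (F := fun (n : ℕ) ω => |rangeCapacity μ S 0 n ω / n - escapeProb μ S|) (f := fun _ => 0)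
      (fun _ => 1) (fun n => ?_) (integrable_const 1) (fun n => ?_) ?_
    · simpa using h
    · exact (((haesm n).aemeasurable.div_const _).sub_const _).abs.aestronglyMeasurable
    · filter_upwards [hcap] with ω hω
      have h1 : 0 ≤ rangeCapacity μ S 0 n ω / n := by
        rw [hω n]; exact div_nonneg (gapCapacity_nonneg _ _ _) (Nat.cast_nonneg n)
      have h2 : rangeCapacity μ S 0 n ω / n ≤ 1 := by
        rw [hω n]; exact div_le_one_of_le₀ (gapCapacity_le _ _ _) (Nat.cast_nonneg n)
      have h3 : 0 ≤ escapeProb μ S := measureReal_nonneg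
      have h4 : escapeProb μ S ≤ 1 := measureReal_le_one
      rw [Real.norm_of_nonneg (abs_nonneg _), abs_le]
      constructor <;> linarith
    · filter_upwards [hlim] with ω hω
      simpa using (hω.sub_const (escapeProb μ S)).abs
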